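/- For integers $n\geq 2$, $j\geq 0$ and real $\alpha\in[0,n]$ let $$\gamma_{n,j,\alpha}=\pi^{n/2-\alpha}\,\frac{\Gamma((j+\alpha)/2)}{\Gamma((j+n-\alpha)/2)},$$ with the convention $1/\Gamma(0)=0$ (so $\gamma_{n,0,n}=0$). A spherical harmonic of degree $j$ on the unit sphere $\mathbb{S}^{n-1}\subset\mathbb{R}^n$ is the restriction to $\mathbb{S}^{n-1}$ of a complex homogeneous polynomial of degree $j$ that is harmonic on $\mathbb{R}^n$; $\sigma$ is the surface measure on $\mathbb{S}^{n-1}$. The Fourier transform is $\widehat f(\xi)=\int_{\mathbb{R}^n} f(x)e^{-2\pi i x\cdot\xi}\,dx$, and $T_m$ denotes the operator $\widehat{T_mf}=m\widehat f$. Its norms below are allowed to be $\infty$; they are suprema over $f\in \mathrm{L}^2\cap \mathrm{L}^p$ with $\|f\|_{\mathrm{L}^p}=1$, and $\|g\|_{\mathrm{L}^{1,\infty}}=\sup_{t>0}t\,|\{|g|>t\}|$. There is an absolute constant $c>0$ and, for every integer $n\ge 2$, a constant $c_n>0$ depending only on $n$ such that the following holds. Let $p\in[1,2]$ and $q\in[2,\infty]$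 satisfy $1/p+1/q=1$, let $m:\mathbb{R}^n\setminus\{0\}\to\mathbb{C}$ be bounded, Borel measurable and homogeneous of degree $0$, and let $(Y_j)_{j\ge0}$ be a sequence such that each $Y_j$ is a spherical harmonic of degree $j$ on $\mathbb{S}^{n-1}$, the series $\sum_{j=0}^\infty Y_j$ converges in $\mathrm{L}^q(\mathbb{S}^{n-1})$ to a function $u$, and the series $\sum_{j=0}^\infty i^{-j}\gamma_{n,j,n/p}Y_j$ converges in $\mathrm{L}^2(\mathbb{S}^{n-1})$ to a function $v$. If $p>1$ (so $q<\infty$), then $$\|T_m\|_{\mathrm{L}^p(\mathbb{R}^n)\to \mathrm{L}^p(\mathbb{R}^n)}\ \geq\ \frac{\gamma_{n,0,n/q}}{\sigma(\mathbb{S}^{n-1})^{1/p}}\,\frac{|\langle m,v\rangle_{\mathrm{L}^2(\mathbb{S}^{n-1})}|}{\|u\|_{\mathrm{L}^q(\mathbb{S}^{n-1})}}\ \geq\ c_n\,(q-1)\,\frac{|\langle m,v\rangle_{\mathrm{L}^2(\mathbb{S}^{n-1})}|}{\|u\|_{\mathrm{L}^q(\mathbb{S}^{n-1})}},$$ while if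 $p=1$ (so $q=\infty$), then $$\|T_m\|_{\mathrm{L}^1(\mathbb{R}^n)\to \mathrm{L}^{1,\infty}(\mathbb{R}^n)}\ \geq\ \frac{c}{n}\,\frac{|\langle m,v\rangle_{\mathrm{L}^2(\mathbb{S}^{n-1})}|}{\|u\|_{\mathrm{L}^\infty(\mathbb{S}^{n-1})}}.$$ Here, when $u=0$ almost everywhere, the quotient $|\langle m,v\rangle|/\|u\|$ is read as $0/0=0$ (in that case $v=0$ as well). -/

import Mathlib

open MeasureTheory Filter Topology
open scoped ENNReal NNReal FourierTransform

noncomputable section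

/-- The Euclidean space `ℝⁿ`. -/
abbrev Rn (n : ℕ) : Type := EuclideanSpace ℝ (Fin n)

/-- The unit sphere `S^{n-1}` of `ℝⁿ`. -/
abbrev Sph (n : ℕ) : Type := Metric.sphere (0 : Rn n) 1

/-- The surface measure on `S^{n-1}`, with total mass `2 π^{n/2} / Γ(n/2)`. -/
abbrev surf (n : ℕ) : Measure (Sph n) := (volume : Measure (Rn n)).toSphere

/-- `Y` is a (surface) spherical harmonic of degree `j`: the restriction to the sphere of a
polynomial with complex coefficients which is homogeneous of degree `j` and satisfies the
Laplace equation. -/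
def IsSphericalHarmonic (n j : ℕ) (Y : Sph n → ℂ) : Prop :=
  ∃ P : MvPolynomial (Fin n) ℂ, P.IsHomogeneous j ∧
    ∑ i, MvPolynomial.pderiv i (MvPolynomial.pderiv i P) = 0 ∧
    ∀ ω : Sph n, Y ω = MvPolynomial.eval (fun i => ((ω : Rn n) i : ℂ)) P

/-- `γ_{n,j,α} = π^{n/2-α} Γ((j+α)/2) / Γ((j+n-α)/2)`. For `j = 0` and `α = n` the value is `0`,
in agreement with the usual convention `1/Γ(0) = 0`. -/
def gammaCoeff (n j : ℕ) (α : ℝ) : ℝ :=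
  Real.pi ^ ((n : ℝ) / 2 - α) * (Real.Gamma ((j + α) / 2) / Real.Gamma ((j + n - α) / 2))

/-- A bounded Borel measurable symbol on `ℝⁿ \ {0}`, homogeneous of degree `0`.
The value of `toFun` at the origin is unrestricted and irrelevant. -/
structure HomSymbol (n : ℕ) where
  toFun : Rn n → ℂ
  measurable' : Measurable toFun
  bounded' : ∃ C : ℝ, ∀ ξ : Rn n, ξ ≠ 0 → ‖toFun ξ‖ ≤ C
  homogeneous' : ∀ t : ℝ, 0 < t → ∀ ξ : Rn n, ξ ≠ 0 → toFun (t • ξ) = toFun ξ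

namespace HomSymbol

variable {n : ℕ}

theorem memLp_mul (m : HomSymbol n) (f : Lp ℂ 2 (volume : Measure (Rn n))) :
    MemLp (fun ξ => m.toFun ξ * f ξ) 2 (volume : Measure (Rn n)) := by
  obtain ⟨C, hC⟩ := m.bounded'
  refine MemLp.of_le_mul (c := max C ‖m.toFun 0‖) (Lp.memLp f)
    (m.measurable'.aestronglyMeasurable.mul (Lp.aestronglyMeasurable f)) (ae_of_all _ fun ξ => ?_)
  rw [norm_mul]
  refine mul_le_mul_of_nonneg_right ?_ (norm_nonneg _)
  rcases eq_or_ne ξ 0 with rfl | h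
  · exact le_max_right _ _
  · exact (hC ξ h).trans (le_max_left _ _)

/-- The Fourier multiplier operator `T_m` on `L²(ℝⁿ)`: the Fourier transform of `T_m f` is the
product of `m` and the Fourier transform of `f`. -/
def op (m : HomSymbol n) (f : Lp ℂ 2 (volume : Measure (Rn n))) :
    Lp ℂ 2 (volume : Measure (Rn n)) :=
  𝓕⁻ ((m.memLp_mul (𝓕 f)).toLp (fun ξ => m.toFun ξ * (𝓕 f) ξ))

/-- The norm of `T_m` as an operator from `L^p` to `L^p`, possibly infinite, computed on the
functions from the dense subspace `L² ∩ L^p`, on which `T_m` is defined. -/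
def normLp (m : HomSymbol n) (p : ℝ≥0∞) : ℝ≥0∞ :=
  ⨆ (f : Lp ℂ 2 (volume : Measure (Rn n))) (_ : eLpNorm f p volume = 1),
    eLpNorm (m.op f) p volume

end HomSymbol

/-- The weak `L¹` quasinorm `sup_{t > 0} t |{x : |g(x)| > t}|`. -/
def weakL1Norm {n : ℕ} (g : Rn n → ℂ) : ℝ≥0∞ :=
  ⨆ t : ℝ≥0, (t : ℝ≥0∞) * volume {x | (t : ℝ≥0∞) < ‖g x‖ₑ}

/-- The norm of `T_m` as an operator from `L¹` to weak `L¹`, possibly infinite, computed on the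
functions from the dense subspace `L¹ ∩ L²`. -/
def HomSymbol.normWeakL1 {n : ℕ} (m : HomSymbol n) : ℝ≥0∞ :=
  ⨆ (f : Lp ℂ 2 (volume : Measure (Rn n))) (_ : eLpNorm f 1 volume = 1), weakL1Norm (m.op f)

/-- The inner product of `m` and `v` in `L²(S^{n-1})`. -/
def sphInner {n : ℕ} (m : HomSymbol n) (v : Sph n → ℂ) : ℂ :=
  ∫ ω, m.toFun (ω : Rn n) * (starRingEnd ℂ) (v ω) ∂(surf n)

/-- The series `∑ Y_j` converges to `u ∈ L^q(S^{n-1})` in the norm of `L^q(S^{n-1})`. -/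
def SeriesConverges {n : ℕ} (q : ℝ≥0∞) (Y : ℕ → Sph n → ℂ) (u : Sph n → ℂ) : Prop :=
  MemLp u q (surf n) ∧
    Tendsto (fun J : ℕ => eLpNorm (fun ω => (∑ j ∈ Finset.range J, Y j ω) - u ω) q (surf n))
      atTop (𝓝 0)

end

open MeasureTheory Filter Topology
open scoped ENNReal NNReal FourierTransform

noncomputable section

/-! The bound is duality tested on a nearly extremal pair. Formally take f(x) = |x|^{-n/p} and g(x)
= |x|^{-n/q} u(x/|x|). The Fourier transform of |x|^{-β} Y_j(x/|x|) is i^{-j} γ_{n,j,n-β} |ξ|^{β-n}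
Y_j(ξ/|ξ|), so f has transform γ_{n,0,n/q} |ξ|^{-n/q} and g has transform |ξ|^{-n/p} v(ξ/|ξ|). By
Parseval, ⟨T_m f, g⟩ equals γ_{n,0,n/q} ⟨m, v⟩ times ∫ dr/r, while ‖f‖_p ‖g‖_q equals σ^{1/p} ‖u‖_q
times the same divergent integral. The quotient is the lower bound.

The truncation is chosen to be stable under the Fourier transform. The power r^{-2a} is proportional
to the integral of e^{aτ} exp(-π e^τ r²) over τ, and `gaussSup` restricts it to |τ| ≤ L. By the
Hecke–Bochner identity the transform of such a truncated function has the same form, with no error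
term (`fourier_harmonic_mul_gaussSup`). In the variable r = e^{Ls/2} a truncated power is the exact
power times `cutoff`, which tends to the indicator of |s| < 1 under an exponential bound uniform in
L. Hence L → ∞ is dominated convergence, and the common factor L/2 cancels
(`gammaCoeff_mul_enorm_le`). This handles finite sums of harmonics;
`mul_enorm_sphInner_le_of_series` passes to series. The constant c_n is a minimum over 1/q in [0,
1/2] (`exists_le_gammaCoeff_div`).

For p = 1, Marcinkiewicz interpolation between the weak L¹ norm A and the L² bound (`normLp_le`)
gives an L^p norm growing at most like 2A/(p-1) as p → 1. The factor γ_{n,0,n/q} has a pole of the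
same order at 1/q = 0. Comparing the leading coefficients removes the supremum of m and leaves the
constant 1/(2n). -/

/-- On `L¹ ∩ L²` the Plancherel extension of the Fourier transform is the Fourier integral. -/
theorem Lp_fourier_toLp_eq {n : ℕ} {f : Rn n → ℂ} (hf1 : Integrable f) (hf2 : MemLp f 2)
    (hg2 : MemLp (𝓕 f) 2) : 𝓕 (hf2.toLp f) = hg2.toLp (𝓕 f) := by
  -- Both sides are compared as tempered distributions: self-adjointness of the Fourier integral
  -- moves the transform onto the Schwartz function, and L² embeds injectively.
  have key : Lp.toTemperedDistribution (𝓕 (hf2.toLp f)) =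
      Lp.toTemperedDistribution (hg2.toLp (𝓕 f)) := by
    rw [← Lp.fourier_toTemperedDistribution_eq]
    ext φ
    rw [TemperedDistribution.fourier_apply, Lp.toTemperedDistribution_apply,
      Lp.toTemperedDistribution_apply]
    have h1 : ∫ x, (𝓕 φ) x • (hf2.toLp f) x = ∫ x, (𝓕 (φ : Rn n → ℂ)) x • f x := by
      refine integral_congr_ae ?_
      filter_upwards [hf2.coeFn_toLp] with x hx
      rw [hx, SchwartzMap.fourier_coe]
    have h2 : ∫ x, φ x • (hg2.toLp (𝓕 f)) x = ∫ x, φ x • (𝓕 f) x := by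
      refine integral_congr_ae ?_
      filter_upwards [hg2.coeFn_toLp] with x hx
      rw [hx]
    rw [h1, h2]
    have := VectorFourier.integral_fourierIntegral_smul_eq_flip (L := innerₗ (Rn n))
      Real.continuous_fourierChar (by exact continuous_inner) (φ.integrable (μ := volume)) hf1
    rw [flip_innerₗ] at this
    exact this
  have hker := Lp.ker_toTemperedDistributionCLM_eq_bot (E := Rn n) (F := ℂ) (μ := volume) (p := 2)
  exact LinearMap.ker_eq_bot.mp hker key

/-! ### The operator T_m: linearity, Parseval, duality. -/

namespace HomSymbol

variable {n : ℕ}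

theorem fourier_op (m : HomSymbol n) (f : Lp ℂ 2 (volume : Measure (Rn n))) :
    𝓕 (m.op f) = (m.memLp_mul (𝓕 f)).toLp (fun ξ => m.toFun ξ * (𝓕 f) ξ) := by
  rw [op, FourierTransform.fourier_fourierInv_eq]

theorem op_add (m : HomSymbol n) (f g : Lp ℂ 2 (volume : Measure (Rn n))) :
    m.op (f + g) = m.op f + m.op g := by
  have : 𝓕 (m.op (f + g)) = 𝓕 (m.op f + m.op g) := by
    rw [FourierAdd.fourier_add, fourier_op, fourier_op, fourier_op]
    apply Lp.ext
    filter_upwards [(m.memLp_mul (𝓕 (f + g))).coeFn_toLp, (m.memLp_mul (𝓕 f)).coeFn_toLp,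
      (m.memLp_mul (𝓕 g)).coeFn_toLp, Lp.coeFn_add
      ((m.memLp_mul (𝓕 f)).toLp (fun ξ => m.toFun ξ * (𝓕 f) ξ))
      ((m.memLp_mul (𝓕 g)).toLp (fun ξ => m.toFun ξ * (𝓕 g) ξ)),
      Lp.coeFn_add (𝓕 f) (𝓕 g)] with x h1 h2 h3 h4 h5
    rw [h1, h4, Pi.add_apply, h2, h3, FourierAdd.fourier_add, h5, Pi.add_apply, mul_add]
  exact (Lp.fourierTransformₗᵢ (Rn n) ℂ).injective this

theorem op_smul (m : HomSymbol n) (c : ℂ) (f : Lp ℂ 2 (volume : Measure (Rn n))) :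
    m.op (c • f) = c • m.op f := by
  have : 𝓕 (m.op (c • f)) = 𝓕 (c • m.op f) := by
    rw [FourierSMul.fourier_smul, fourier_op, fourier_op]
    apply Lp.ext
    filter_upwards [(m.memLp_mul (𝓕 (c • f))).coeFn_toLp, (m.memLp_mul (𝓕 f)).coeFn_toLp,
      Lp.coeFn_smul c ((m.memLp_mul (𝓕 f)).toLp (fun ξ => m.toFun ξ * (𝓕 f) ξ)),
      Lp.coeFn_smul c (𝓕 f)] with x h1 h2 h4 h5
    rw [h1, h4, Pi.smul_apply, h2, FourierSMul.fourier_smul, h5, Pi.smul_apply]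
    simp only [smul_eq_mul]
    ring
  exact (Lp.fourierTransformₗᵢ (Rn n) ℂ).injective this

/-- Parseval: on the frequency side T_m is multiplication by m. -/
theorem inner_op (m : HomSymbol n) (f g : Lp ℂ 2 (volume : Measure (Rn n))) :
    ∫ x, (m.op f) x * (starRingEnd ℂ) (g x) =
      ∫ ξ, m.toFun ξ * (𝓕 f) ξ * (starRingEnd ℂ) ((𝓕 g) ξ) := by
  have h := Lp.inner_fourier_eq g (m.op f)
  rw [fourier_op, L2.inner_def, L2.inner_def] at h
  simp only [RCLike.inner_apply] at h
  rw [← h]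
  refine integral_congr_ae ?_
  filter_upwards [(m.memLp_mul (𝓕 f)).coeFn_toLp] with x hx
  rw [hx]

theorem exists_norm_le (m : HomSymbol n) : ∃ M : ℝ, 0 < M ∧ ∀ ξ, ‖m.toFun ξ‖ ≤ M := by
  obtain ⟨C, hC⟩ := m.bounded'
  refine ⟨max C ‖m.toFun 0‖ + 1, by positivity, fun ξ => ?_⟩
  rcases eq_or_ne ξ 0 with rfl | h
  · exact (le_max_right _ _).trans (by linarith)
  · exact ((hC ξ h).trans (le_max_left _ _)).trans (by linarith)

/-- The supremum defining `normLp` sees only normalized functions, so f is rescaled. A function of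
norm zero cannot be rescaled, and since ∞ * 0 = 0 it requires T_m 0 = 0. -/
theorem eLpNorm_op_le_of_normLp (m : HomSymbol n) {p : ℝ≥0∞}
    (f : Lp ℂ 2 (volume : Measure (Rn n))) (hp : p ≠ 0) (hf : eLpNorm f p volume ≠ ∞) :
    eLpNorm (m.op f) p volume ≤ m.normLp p * eLpNorm f p volume := by
  rcases eq_or_ne (eLpNorm f p volume) 0 with h0 | h0
  · have hf0 : f = 0 := by
      rw [eLpNorm_eq_zero_iff (Lp.aestronglyMeasurable f) hp] at h0
      exact Lp.eq_zero_iff_ae_eq_zero.mpr h0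
    have : m.op f = 0 := by
      have := m.op_smul 0 f
      rw [zero_smul, zero_smul] at this
      rw [hf0, this]
    rw [this, eLpNorm_congr_ae (Lp.coeFn_zero ℂ 2 volume)]
    simp
  · set N := (eLpNorm f p volume).toReal with hN
    have hNpos : 0 < N := ENNReal.toReal_pos h0 hf
    have hNe : ENNReal.ofReal N = eLpNorm f p volume := ENNReal.ofReal_toReal hf
    set c : ℂ := ((N⁻¹ : ℝ) : ℂ) with hc
    have hce : ‖c‖ₑ = (eLpNorm f p volume)⁻¹ := by
      rw [← hNe, ← ENNReal.ofReal_inv_of_pos hNpos, ← ofReal_norm, hc, Complex.norm_real,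
        Real.norm_of_nonneg (inv_nonneg.mpr hNpos.le)]
    have h1 : eLpNorm (c • f : Lp ℂ 2 (volume : Measure (Rn n))) p volume = 1 := by
      rw [eLpNorm_congr_ae (Lp.coeFn_smul c f), eLpNorm_const_smul, hce,
          ENNReal.inv_mul_cancel h0 hf]
    have h2 : eLpNorm (m.op (c • f)) p volume ≤ m.normLp p := by
      rw [normLp]
      exact le_iSup₂ (f := fun (f : Lp ℂ 2 (volume : Measure (Rn n)))
        (_ : eLpNorm f p volume = 1) => eLpNorm (m.op f) p volume) (c • f) h1
    rw [op_smul, eLpNorm_congr_ae (Lp.coeFn_smul c _), eLpNorm_const_smul, hce,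
      mul_comm, ← div_eq_mul_inv] at h2
    exact (ENNReal.div_le_iff h0 hf).mp h2

theorem integral_op_toLp (m : HomSymbol n)
    {f g : Rn n → ℂ} (hf1 : Integrable f) (hf2 : MemLp f 2)
    (hf2' : MemLp (𝓕 f) 2) (hg1 : Integrable g) (hg2 : MemLp g 2) (hg2' : MemLp (𝓕 g) 2) :
    ∫ ξ, m.toFun ξ * (𝓕 f) ξ * (starRingEnd ℂ) ((𝓕 g) ξ) =
      ∫ x, (m.op (hf2.toLp f)) x * (starRingEnd ℂ) (g x) := by
  trans ∫ x, (m.op (hf2.toLp f)) x * (starRingEnd ℂ) (hg2.toLp g x)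
  · rw [inner_op, Lp_fourier_toLp_eq hf1 hf2 hf2', Lp_fourier_toLp_eq hg1 hg2 hg2']
    refine integral_congr_ae ?_
    filter_upwards [hf2'.coeFn_toLp, hg2'.coeFn_toLp] with x h1 h2
    rw [h1, h2]
  · refine integral_congr_ae ?_
    filter_upwards [hg2.coeFn_toLp] with x h2
    rw [h2]

theorem enorm_integral_mul_conj_le {p q : ℝ≥0∞} [p.HolderConjugate q] {f g : Rn n → ℂ}
    (hf : AEStronglyMeasurable f volume) (hg : AEStronglyMeasurable g volume) :
    ‖∫ x, f x * (starRingEnd ℂ) (g x)‖ₑ ≤ eLpNorm f p volume * eLpNorm g q volume := by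
  have h1 : eLpNorm (fun x => (starRingEnd ℂ) (g x)) q volume = eLpNorm g q volume :=
    eLpNorm_congr_norm_ae (ae_of_all _ fun x => by simp)
  refine (enorm_integral_le_lintegral_enorm _).trans ?_
  rw [← eLpNorm_one_eq_lintegral_enorm, ← h1]
  have h2 := eLpNorm_smul_le_mul_eLpNorm (p := p) (q := q) (r := 1)
    (Complex.continuous_conj.comp_aestronglyMeasurable hg) hf
  exact h2

/-- Duality bound for the bilinear form of `T_m` on functions in `L¹ ∩ L²`. -/
theorem enorm_integral_fourier_le (m : HomSymbol n) {p q : ℝ≥0∞} [p.HolderConjugate q]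
    (hp : p ≠ 0)
    {f g : Rn n → ℂ} (hf1 : Integrable f) (hf2 : MemLp f 2) (hfp : MemLp f p)
    (hf2' : MemLp (𝓕 f) 2) (hg1 : Integrable g) (hg2 : MemLp g 2) (hg2' : MemLp (𝓕 g) 2) :
    ‖∫ ξ, m.toFun ξ * (𝓕 f) ξ * (starRingEnd ℂ) ((𝓕 g) ξ)‖ₑ ≤
      m.normLp p * eLpNorm f p volume * eLpNorm g q volume := by
  have e2 : eLpNorm (hf2.toLp f) p volume = eLpNorm f p volume :=
    eLpNorm_congr_ae hf2.coeFn_toLp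
  have e3 := m.eLpNorm_op_le_of_normLp (hf2.toLp f) hp (by rw [e2]; exact hfp.eLpNorm_ne_top)
  rw [e2] at e3
  rw [m.integral_op_toLp hf1 hf2 hf2' hg1 hg2 hg2']
  exact (enorm_integral_mul_conj_le (p := p) (q := q) (Lp.aestronglyMeasurable _) hg1.1).trans
    (by gcongr)

end HomSymbol

/-! ### Polynomials, the Laplacian and the heat operator. -/

/-- The value at a point of `ℝⁿ` of a polynomial with complex coefficients. -/
def polyVal {n : ℕ} (P : MvPolynomial (Fin n) ℂ) (x : Rn n) : ℂ :=
  MvPolynomial.eval (fun i => (x i : ℂ)) P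

/-- The Laplace operator on polynomials. -/
def polyLaplacian (n : ℕ) : Module.End ℂ (MvPolynomial (Fin n) ℂ) :=
  ∑ i, (MvPolynomial.pderiv i).toLinearMap * (MvPolynomial.pderiv i).toLinearMap

/-- A partial sum of the heat operator `exp (c Δ)` applied to a polynomial. -/
def heatSum {n : ℕ} (K : ℕ) (c : ℂ) (P : MvPolynomial (Fin n) ℂ) : MvPolynomial (Fin n) ℂ :=
  ∑ k ∈ Finset.range K, (c ^ k / (k.factorial : ℂ)) • (polyLaplacian n ^ k) P

section Algebra

open MvPolynomial

variable {n : ℕ}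

theorem polyLaplacian_apply (P : MvPolynomial (Fin n) ℂ) :
    polyLaplacian n P = ∑ i, pderiv i (pderiv i P) := by
  simp [polyLaplacian, LinearMap.sum_apply, Module.End.mul_apply]

theorem pderiv_pderiv_comm (i k : Fin n) (P : MvPolynomial (Fin n) ℂ) :
    pderiv i (pderiv k P) = pderiv k (pderiv i P) := by
  induction P using MvPolynomial.induction_on with
  | C a => simp
  | add p q hp hq => simp [hp, hq]
  | mul_X p l hp =>
    simp only [pderiv_mul, map_add, hp]
    have h : ∀ a b : Fin n, pderiv a (pderiv b (X l : MvPolynomial (Fin n) ℂ)) = 0 := by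
      intro a b
      rcases eq_or_ne l b with rfl | hb
      · rw [pderiv_X_self, pderiv_one]
      · rw [pderiv_X_of_ne hb, map_zero]
    rw [h, h]
    ring

theorem polyLaplacian_pderiv (i : Fin n) (P : MvPolynomial (Fin n) ℂ) :
    polyLaplacian n (pderiv i P) = pderiv i (polyLaplacian n P) := by
  rw [polyLaplacian_apply, polyLaplacian_apply, map_sum]
  refine Finset.sum_congr rfl fun k _ => ?_
  rw [pderiv_pderiv_comm k i P, pderiv_pderiv_comm k i (pderiv k P)]

theorem polyLaplacian_X_mul (i : Fin n) (P : MvPolynomial (Fin n) ℂ) :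
    polyLaplacian n (X i * P) = X i * polyLaplacian n P + (2 : ℂ) • pderiv i P := by
  rw [polyLaplacian_apply, polyLaplacian_apply, Finset.mul_sum]
  have : ∀ k : Fin n, pderiv k (pderiv k (X i * P)) =
      X i * pderiv k (pderiv k P) + if k = i then (2 : ℂ) • pderiv i P else 0 := by
    intro k
    rw [pderiv_mul, map_add, pderiv_mul, pderiv_mul]
    rcases eq_or_ne k i with rfl | h
    · simp [two_smul]
      ring
    · simp [pderiv_X_of_ne h.symm, h]
  rw [Finset.sum_congr rfl fun k _ => this k, Finset.sum_add_distrib]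
  simp

/-- The commutator of Δ with x_i is 2∂_i, which commutes with Δ; each of the k + 1 factors
contributes it once. -/
theorem polyLaplacian_pow_X_mul (i : Fin n) (P : MvPolynomial (Fin n) ℂ) (k : ℕ) :
    (polyLaplacian n ^ (k + 1)) (X i * P) = X i * (polyLaplacian n ^ (k + 1)) P +
      (2 * (k + 1) : ℂ) • pderiv i ((polyLaplacian n ^ k) P) := by
  induction k with
  | zero => simp [polyLaplacian_X_mul]
  | succ k ih =>
    rw [pow_succ' (polyLaplacian n) (k + 1), Module.End.mul_apply, ih, map_add,
      polyLaplacian_X_mul, map_smul, polyLaplacian_pderiv, ← Module.End.mul_apply, ← pow_succ',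
      ← Module.End.mul_apply, ← pow_succ', add_assoc, ← add_smul]
    push_cast
    ring_nf

/-- Conjugation by exp(cΔ) turns multiplication by x_i into x_i + 2c ∂_i. The derivative term uses
up one Laplacian, which is why its truncation is one shorter. -/
theorem heatSum_X_mul (i : Fin n) (P : MvPolynomial (Fin n) ℂ) (c : ℂ) (K : ℕ) :
    heatSum (K + 1) c (X i * P) =
      X i * heatSum (K + 1) c P + (2 * c) • pderiv i (heatSum K c P) := by
  rw [heatSum, heatSum, heatSum, Finset.sum_range_succ', Finset.sum_range_succ', mul_add, map_sum,
    Finset.smul_sum, Finset.mul_sum, add_right_comm, ← Finset.sum_add_distrib]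
  congr 1
  · refine Finset.sum_congr rfl fun k _ => ?_
    rw [polyLaplacian_pow_X_mul, smul_add, Derivation.map_smul, smul_smul, smul_smul, mul_smul_comm]
    congr 2
    rw [Nat.factorial_succ]
    have h1 : ((k : ℂ) + 1) ≠ 0 := by exact_mod_cast Nat.succ_ne_zero k
    have h2 : (k.factorial : ℂ) ≠ 0 := by exact_mod_cast Nat.factorial_ne_zero k
    push_cast
    field_simp
    ring
  · simp

theorem heatSum_of_polyLaplacian_eq_zero {P : MvPolynomial (Fin n) ℂ}
    (hP : polyLaplacian n P = 0) (c : ℂ) (K : ℕ) : heatSum (K + 1) c P = P := by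
  rw [heatSum, Finset.sum_range_succ', Finset.sum_eq_zero]
  · simp
  · intro k _
    rw [pow_succ (polyLaplacian n), Module.End.mul_apply, hP, map_zero, smul_zero]

/-- Serves to differentiate the formula for the transform of a polynomial times a Gaussian along a
coordinate line. -/
theorem hasDerivAt_eval_line (Q : MvPolynomial (Fin n) ℂ) (c : ℂ) (ξ : Rn n) (i : Fin n) :
    HasDerivAt (fun s : ℝ => eval (fun k => c * ((ξ + s • EuclideanSpace.single i (1 : ℝ)) k : ℂ))
        Q)
      (c * eval (fun k => c * (ξ k : ℂ)) (pderiv i Q)) 0 := by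
  induction Q using MvPolynomial.induction_on with
  | C a => simpa using hasDerivAt_const (0 : ℝ) a
  | add p q hp hq =>
    convert! hp.add hq using 1
    · ext s; simp
    · simp [mul_add]
  | mul_X p k hp =>
    have h1 : HasDerivAt (fun s : ℝ => c * ((ξ + s • EuclideanSpace.single i (1 : ℝ)) k : ℂ))
        (c * if k = i then 1 else 0) 0 := by
      refine HasDerivAt.const_mul c ?_
      have : HasDerivAt (fun s : ℝ => ξ k + s * (if k = i then (1 : ℝ) else 0))
          (if k = i then (1 : ℝ) else 0) 0 := by
        simpa using ((hasDerivAt_id (0 : ℝ)).mul_const (if k = i then (1 : ℝ) else 0)).const_add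
            (ξ k)
      convert! this.ofReal_comp using 1
      · ext s
        simp
      · split_ifs <;> simp
    convert! hp.mul h1 using 1
    · ext s; simp
    · simp only [pderiv_mul, map_add, map_mul, eval_X, zero_smul, add_zero]
      rcases eq_or_ne k i with rfl | h
      · simp; ring
      · simp [h, pderiv_X_of_ne h]; ring

end Algebra

/-! ### Gaussian domination of polynomials. -/

section Growth

variable {n : ℕ}

theorem continuous_polyVal (P : MvPolynomial (Fin n) ℂ) : Continuous (polyVal P) := by
  unfold polyVal
  exact (MvPolynomial.continuous_eval P).comp (by fun_prop)

theorem eval_mul_of_isHomogeneous {P : MvPolynomial (Fin n) ℂ} {j : ℕ} (hP : P.IsHomogeneous j)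
    (c : ℂ) (z : Fin n → ℂ) :
    MvPolynomial.eval (fun k => c * z k) P = c ^ j * MvPolynomial.eval z P := by
  rw [MvPolynomial.eval_eq', MvPolynomial.eval_eq', Finset.mul_sum]
  refine Finset.sum_congr rfl fun d hd => ?_
  have hdeg : ∑ i, d i = j := by
    have := hP (MvPolynomial.mem_support_iff.mp hd)
    rwa [Finsupp.weight_apply, Finsupp.sum_fintype _ _ (by simp), Finset.sum_congr rfl
      (fun i _ => by simp : ∀ i ∈ Finset.univ, d i • (1 : Fin n → ℕ) i = d i)] at this
  simp only [mul_pow, Finset.prod_mul_distrib, Finset.prod_pow_eq_pow_sum, hdeg]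
  ring

theorem polyVal_smul {P : MvPolynomial (Fin n) ℂ} {j : ℕ} (hP : P.IsHomogeneous j) (r : ℝ)
    (x : Rn n) : polyVal P (r • x) = (r : ℂ) ^ j * polyVal P x := by
  rw [polyVal, polyVal, ← eval_mul_of_isHomogeneous hP]
  simp

/-- The statement is proved for all ε at once because the induction spends ε/2 on each new factor
x_k. -/
theorem exists_norm_polyVal_le (P : MvPolynomial (Fin n) ℂ) :
    ∀ ε : ℝ, 0 < ε → ∃ C : ℝ, 0 ≤ C ∧ ∀ x : Rn n, ‖polyVal P x‖ ≤ C * Real.exp (ε * ‖x‖ ^ 2) := by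
  induction P using MvPolynomial.induction_on with
  | C a =>
    intro ε hε
    refine ⟨‖a‖, norm_nonneg _, fun x => ?_⟩
    simp only [polyVal, MvPolynomial.eval_C]
    exact le_mul_of_one_le_right (norm_nonneg _) (Real.one_le_exp (by positivity))
  | add p q hp hq =>
    intro ε hε
    obtain ⟨C, hC, h1⟩ := hp ε hε
    obtain ⟨D, hD, h2⟩ := hq ε hε
    refine ⟨C + D, by positivity, fun x => ?_⟩
    have : polyVal (p + q) x = polyVal p x + polyVal q x := by simp [polyVal]
    rw [this, add_mul]
    exact (norm_add_le _ _).trans (add_le_add (h1 x) (h2 x))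
  | mul_X p k hp =>
    intro ε hε
    obtain ⟨C, hC, h1⟩ := hp (ε / 2) (by positivity)
    refine ⟨C * (1 + 2 / ε), by positivity, fun x => ?_⟩
    have : polyVal (p * MvPolynomial.X k) x = polyVal p x * (x k : ℂ) := by simp [polyVal]
    rw [this, norm_mul]
    have h2 : ‖(x k : ℂ)‖ ≤ (1 + 2 / ε) * Real.exp (ε / 2 * ‖x‖ ^ 2) := by
      have e1 : ‖(x k : ℂ)‖ ≤ ‖x‖ := by
        rw [Complex.norm_real]; exact PiLp.norm_apply_le x k
      have e2 := Real.add_one_le_exp (ε / 2 * ‖x‖ ^ 2)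
      have e3 : ‖x‖ ≤ 1 + ‖x‖ ^ 2 := by nlinarith [sq_nonneg (‖x‖ - 1), norm_nonneg x]
      have e4 : (1 + 2 / ε) * (ε / 2 * ‖x‖ ^ 2 + 1) =
        1 + ‖x‖ ^ 2 + (ε / 2 * ‖x‖ ^ 2 + 2 / ε) := by field_simp; ring
      have e5 : 0 ≤ ε / 2 * ‖x‖ ^ 2 + 2 / ε := by positivity
      calc ‖(x k : ℂ)‖ ≤ (1 + 2 / ε) * (ε / 2 * ‖x‖ ^ 2 + 1) := by linarith
        _ ≤ _ := by gcongr
    calc ‖polyVal p x‖ * ‖(x k : ℂ)‖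
        ≤ (C * Real.exp (ε / 2 * ‖x‖ ^ 2)) * ((1 + 2 / ε) * Real.exp (ε / 2 * ‖x‖ ^ 2)) := by
          gcongr; exact h1 x
      _ = C * (1 + 2 / ε) * (Real.exp (ε / 2 * ‖x‖ ^ 2) * Real.exp (ε / 2 * ‖x‖ ^ 2)) := by ring
      _ = _ := by rw [← Real.exp_add]; ring_nf

theorem integrable_exp_neg_mul_norm_sq {b : ℝ} (hb : 0 < b) :
    Integrable (fun x : Rn n => Real.exp (-b * ‖x‖ ^ 2)) := by
  have := (GaussianFourier.integrable_cexp_neg_mul_sq_norm_add (V := Rn n) (b := (b : ℂ))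
    (by simpa using hb) 0 0).norm
  refine this.congr (ae_of_all _ fun x => ?_)
  simp only [Complex.norm_exp, zero_mul, add_zero]
  congr 1
  rw [← Complex.ofReal_neg, ← Complex.ofReal_pow, ← Complex.ofReal_mul, Complex.ofReal_re]

theorem memLp_of_norm_le_gaussian {f : Rn n → ℂ} (hf : AEStronglyMeasurable f volume) {C b : ℝ}
    (hb : 0 < b) (h : ∀ x, ‖f x‖ ≤ C * Real.exp (-b * ‖x‖ ^ 2)) {p : ℝ≥0∞} (hp : p ≠ 0)
    (hp' : p ≠ ∞) : MemLp f p := by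
  have hG : MemLp (fun x : Rn n => Real.exp (-b * ‖x‖ ^ 2)) p := by
    rw [← integrable_norm_rpow_iff (by fun_prop) hp hp']
    have hpp := ENNReal.toReal_pos hp hp'
    refine (integrable_exp_neg_mul_norm_sq (n := n) (mul_pos hb hpp)).congr
      (ae_of_all _ fun x => ?_)
    simp only
    rw [Real.norm_of_nonneg (Real.exp_nonneg _), ← Real.exp_mul]
    ring_nf
  refine hG.of_le_mul (c := C) hf (ae_of_all _ fun x => ?_)
  rw [Real.norm_of_nonneg (Real.exp_nonneg _)]
  exact h x

/-- A polynomial times a Gaussian is dominated by a Gaussian. -/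
theorem exists_norm_polyVal_mul_gaussian_le (P : MvPolynomial (Fin n) ℂ) {b : ℝ} (hb : 0 < b) :
    ∃ C : ℝ, 0 ≤ C ∧ ∀ x : Rn n, ‖polyVal P x‖ * Real.exp (-b * ‖x‖ ^ 2) ≤
      C * Real.exp (-(b / 2) * ‖x‖ ^ 2) := by
  obtain ⟨C, hC, h⟩ := exists_norm_polyVal_le P (b / 2) (by positivity)
  refine ⟨C, hC, fun x => ?_⟩
  calc _ ≤ C * Real.exp (b / 2 * ‖x‖ ^ 2) * Real.exp (-b * ‖x‖ ^ 2) := by gcongr; exact h x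
    _ = _ := by rw [mul_assoc, ← Real.exp_add]; ring_nf

theorem integrable_polyVal_mul_gaussian (P : MvPolynomial (Fin n) ℂ) {b : ℝ} (hb : 0 < b) :
    Integrable (fun x : Rn n => polyVal P x * (Real.exp (-b * ‖x‖ ^ 2) : ℂ)) := by
  obtain ⟨C, hC, h⟩ := exists_norm_polyVal_mul_gaussian_le P hb
  rw [← memLp_one_iff_integrable]
  refine memLp_of_norm_le_gaussian (b := b / 2) (C := C) ?_ (by positivity) (fun x => ?_)
      one_ne_zero
    ENNReal.one_ne_top
  · exact ((continuous_polyVal P).mul (by fun_prop)).aestronglyMeasurable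
  · rw [norm_mul, Complex.norm_real, Real.norm_of_nonneg (Real.exp_nonneg _)]
    exact h x

end Growth

/-! ### The Hecke–Bochner identity. -/

section HeckeBochner

open MvPolynomial

variable {n : ℕ}

/-- Multiplication by x_i corresponds to differentiation of the transform; this drives the induction
on polynomials below. -/
theorem hasDerivAt_fourier_line {f : Rn n → ℂ} (hf : Integrable f)
    (hf' : Integrable fun v => ‖v‖ * ‖f v‖) (ξ : Rn n) (i : Fin n) :
    HasDerivAt (fun s : ℝ => (𝓕 f) (ξ + s • EuclideanSpace.single i (1 : ℝ)))
      (-(2 * Real.pi * Complex.I) * (𝓕 (fun x : Rn n => (x i : ℂ) * f x)) ξ) 0 := by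
  have hi : Integrable (VectorFourier.fourierSMulRight (innerSL ℝ) f) := by
    have hm : AEStronglyMeasurable (VectorFourier.fourierSMulRight (innerSL (E := Rn n) ℝ) f)
        volume :=
      hf.1.fourierSMulRight
    refine (hf'.const_mul (2 * Real.pi * ‖innerSL (E := Rn n) ℝ‖)).mono' hm (ae_of_all _ fun v =>
        ?_)
    rw [← mul_assoc]
    exact VectorFourier.norm_fourierSMulRight_le _ f v
  have h := Real.hasFDerivAt_fourier hf hf' ξ
  have h2 : HasFDerivAt (𝓕 f) (𝓕 (VectorFourier.fourierSMulRight (innerSL ℝ) f) ξ)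
      (ξ + (0 : ℝ) • EuclideanSpace.single i (1 : ℝ)) := by simpa using h
  have hl : HasDerivAt (fun s : ℝ => ξ + s • EuclideanSpace.single i (1 : ℝ))
      (EuclideanSpace.single i (1 : ℝ)) 0 := by
    simpa using ((hasDerivAt_id (0 : ℝ)).smul_const (EuclideanSpace.single i (1 : ℝ))).const_add ξ
  have h3 := h2.comp_hasDerivAt (0 : ℝ) hl
  convert! h3 using 1
  rw [Real.fourier_continuousLinearMap_apply hi, Real.fourier_eq, Real.fourier_eq,
    ← integral_const_mul]
  refine integral_congr_ae (ae_of_all _ fun v => ?_)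
  simp only [VectorFourier.fourierSMulRight_apply, Circle.smul_def, smul_eq_mul]
  have e : (innerSL ℝ v) (EuclideanSpace.single i (1 : ℝ)) = v i := by
    change inner ℝ v _ = _
    rw [EuclideanSpace.inner_single_right]
    simp
  rw [e, Complex.real_smul]
  ring

theorem integrable_norm_mul_norm_polyVal_gaussian (P : MvPolynomial (Fin n) ℂ) {b : ℝ}
    (hb : 0 < b) :
    Integrable (fun x : Rn n => ‖x‖ * ‖polyVal P x * (Real.exp (-b * ‖x‖ ^ 2) : ℂ)‖) := by
  obtain ⟨C, hC, h⟩ := exists_norm_polyVal_mul_gaussian_le P hb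
  have key := (integrable_exp_neg_mul_norm_sq (n := n) (b := b / 4) (by positivity)).const_mul
    (C * (1 + 4 / b))
  refine key.mono' ?_ (ae_of_all _ fun x => ?_)
  · exact (continuous_norm.mul ((continuous_polyVal P).mul (by fun_prop)).norm).aestronglyMeasurable
  · rw [norm_mul, norm_norm, norm_norm, norm_mul, Complex.norm_real,
      Real.norm_of_nonneg (Real.exp_nonneg _)]
    have e1 : ‖x‖ ≤ (1 + 4 / b) * Real.exp (b / 4 * ‖x‖ ^ 2) := by
      have e2 := Real.add_one_le_exp (b / 4 * ‖x‖ ^ 2)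
      have e3 : ‖x‖ ≤ 1 + ‖x‖ ^ 2 := by nlinarith [sq_nonneg (‖x‖ - 1), norm_nonneg x]
      have e4 : (1 + 4 / b) * (b / 4 * ‖x‖ ^ 2 + 1) =
        1 + ‖x‖ ^ 2 + (b / 4 * ‖x‖ ^ 2 + 4 / b) := by field_simp; ring
      have e5 : 0 ≤ b / 4 * ‖x‖ ^ 2 + 4 / b := by positivity
      calc ‖x‖ ≤ (1 + 4 / b) * (b / 4 * ‖x‖ ^ 2 + 1) := by linarith
        _ ≤ _ := by gcongr
    calc ‖x‖ * (‖polyVal P x‖ * Real.exp (-b * ‖x‖ ^ 2))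
        ≤ ((1 + 4 / b) * Real.exp (b / 4 * ‖x‖ ^ 2)) * (C * Real.exp (-(b / 2) * ‖x‖ ^ 2)) := by
          exact mul_le_mul e1 (h x) (by positivity) (by positivity)
      _ = C * (1 + 4 / b) * (Real.exp (b / 4 * ‖x‖ ^ 2) * Real.exp (-(b / 2) * ‖x‖ ^ 2)) := by ring
      _ = _ := by rw [← Real.exp_add]; ring_nf

theorem hasDerivAt_gaussian_line (c : ℝ) (ξ : Rn n) (i : Fin n) :
    HasDerivAt (fun s : ℝ =>
        (Real.exp (-c * ‖ξ + s • EuclideanSpace.single i (1 : ℝ)‖ ^ 2) : ℂ))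
      (-(2 * c * ξ i : ℝ) * (Real.exp (-c * ‖ξ‖ ^ 2) : ℂ)) 0 := by
  have hn : ∀ s : ℝ, ‖ξ + s • EuclideanSpace.single i (1 : ℝ)‖ ^ 2 =
      ‖ξ‖ ^ 2 + 2 * s * ξ i + s ^ 2 := by
    intro s
    rw [norm_add_sq_real, inner_smul_right, EuclideanSpace.inner_single_right, norm_smul,
      PiLp.norm_single, mul_pow]
    simp
    ring
  have h1 : HasDerivAt (fun s : ℝ => -c * (‖ξ‖ ^ 2 + 2 * s * ξ i + s ^ 2)) (-c * (2 * ξ i)) 0 := by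
    have h2 : HasDerivAt (fun s : ℝ => ‖ξ‖ ^ 2 + 2 * s * ξ i + s ^ 2) (2 * ξ i) 0 := by
      have h3 := (((hasDerivAt_id (0 : ℝ)).const_mul 2).mul_const (ξ i)).const_add (‖ξ‖ ^ 2)
      have h4 := h3.add ((hasDerivAt_id (0 : ℝ)).pow 2)
      convert! h4 using 1
      simp
    exact h2.const_mul _
  have h5 := h1.exp.ofReal_comp
  convert! h5 using 1
  · ext s
    simp only [hn]
  · simp
    ring

/-- The Fourier transform of a polynomial times a Gaussian, in terms of the heat flow. -/
theorem fourier_polyVal_mul_gaussian (P : MvPolynomial (Fin n) ℂ) {t : ℝ} (ht : 0 < t) :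
    ∃ K₀ : ℕ, ∀ K, K₀ ≤ K → ∀ ξ : Rn n,
      (𝓕 (fun x : Rn n => polyVal P x * (Real.exp (-(Real.pi * t) * ‖x‖ ^ 2) : ℂ))) ξ =
        (t ^ (-(n : ℝ) / 2) : ℝ) *
          eval (fun k => (-Complex.I / t) * (ξ k : ℂ)) (heatSum K (1 / (4 * Real.pi * t)) P) *
          (Real.exp (-(Real.pi / t) * ‖ξ‖ ^ 2) : ℂ) := by
  have hb : 0 < Real.pi * t := by positivity
  have htc : (t : ℂ) ≠ 0 := by exact_mod_cast ht.ne'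
  have hpi : (Real.pi : ℂ) ≠ 0 := by exact_mod_cast Real.pi_ne_zero
  -- Harmonic polynomials are not closed under multiplication by x_i, so the induction runs over all
  -- polynomials, at the price of the heat operator.
  induction P using MvPolynomial.induction_on with
  | C a =>
    -- The truncation at K = 0 is the empty sum, so the threshold has to be at least 1.
    refine ⟨1, fun K hK ξ => ?_⟩
    obtain ⟨K, rfl⟩ := Nat.exists_eq_add_of_le' hK
    rw [heatSum_of_polyLaplacian_eq_zero (by simp [polyLaplacian_apply])]
    have h1 := fourier_gaussian_innerProductSpace (V := Rn n) (b := ((Real.pi * t : ℝ) : ℂ))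
      (by simpa using hb) ξ
    have h2 : (fun x : Rn n => polyVal (C a) x * (Real.exp (-(Real.pi * t) * ‖x‖ ^ 2) : ℂ)) =
        a • fun x : Rn n => Complex.exp (-((Real.pi * t : ℝ) : ℂ) * ‖x‖ ^ 2) := by
      ext x; simp [polyVal]
    have h3 : (𝓕 (a • fun x : Rn n => Complex.exp (-((Real.pi * t : ℝ) : ℂ) * ‖x‖ ^ 2))) ξ =
        a * (𝓕 (fun x : Rn n => Complex.exp (-((Real.pi * t : ℝ) : ℂ) * ‖x‖ ^ 2))) ξ := by
      rw [Real.fourier_eq, Real.fourier_eq, ← integral_const_mul]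
      refine integral_congr_ae (ae_of_all _ fun v => ?_)
      simp only [Pi.smul_apply, Circle.smul_def, smul_eq_mul]
      ring
    have h4 : ((Real.pi : ℂ) / ((Real.pi * t : ℝ) : ℂ)) ^ ((Module.finrank ℝ (Rn n) : ℂ) / 2) =
        ((t ^ (-(n : ℝ) / 2) : ℝ) : ℂ) := by
      have e1 : (Real.pi : ℂ) / ((Real.pi * t : ℝ) : ℂ) = ((t⁻¹ : ℝ) : ℂ) := by
        push_cast; field_simp
      rw [e1, finrank_euclideanSpace_fin, neg_div, Real.rpow_neg ht.le, ← Real.inv_rpow ht.le,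
        Complex.ofReal_cpow (by positivity)]
      push_cast
      rfl
    rw [h2, h3, h1, h4, eval_C]
    have h5 : Complex.exp (-(Real.pi : ℂ) ^ 2 * (‖ξ‖ : ℂ) ^ 2 / ((Real.pi * t : ℝ) : ℂ)) =
        (Real.exp (-(Real.pi / t) * ‖ξ‖ ^ 2) : ℂ) := by
      rw [Complex.ofReal_exp]
      congr 1
      push_cast
      field_simp
    rw [h5]
    ring
  | add p q hp hq =>
    obtain ⟨K1, h1⟩ := hp
    obtain ⟨K2, h2⟩ := hq
    refine ⟨max K1 K2, fun K hK ξ => ?_⟩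
    have h3 := h1 K ((le_max_left _ _).trans hK) ξ
    have h4 := h2 K ((le_max_right _ _).trans hK) ξ
    have h5 : (fun x : Rn n => polyVal (p + q) x * (Real.exp (-(Real.pi * t) * ‖x‖ ^ 2) : ℂ)) =
        (fun x : Rn n => polyVal p x * (Real.exp (-(Real.pi * t) * ‖x‖ ^ 2) : ℂ)) +
        (fun x : Rn n => polyVal q x * (Real.exp (-(Real.pi * t) * ‖x‖ ^ 2) : ℂ)) := by
      ext x; simp [polyVal, add_mul]
    have h6 : ∀ f g : Rn n → ℂ, Integrable f → Integrable g → (𝓕 (f + g)) ξ = (𝓕 f) ξ + (𝓕 g)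
        ξ := by
      intro f g hf hg
      rw [Real.fourier_eq, Real.fourier_eq, Real.fourier_eq, ← integral_add]
      · simp
      · exact (Real.fourierIntegral_convergent_iff ξ).2 hf
      · exact (Real.fourierIntegral_convergent_iff ξ).2 hg
    rw [h5, h6 _ _ (integrable_polyVal_mul_gaussian p hb) (integrable_polyVal_mul_gaussian q hb),
      h3, h4]
    have h7 : heatSum K (1 / (4 * Real.pi * t) : ℂ) (p + q) =
        heatSum K (1 / (4 * Real.pi * t) : ℂ) p + heatSum K (1 / (4 * Real.pi * t) : ℂ) q := by
      simp [heatSum, Finset.sum_add_distrib]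
    rw [h7, map_add]
    ring
  | mul_X p i hp =>
    obtain ⟨K0, h0⟩ := hp
    refine ⟨K0 + 1, fun K hK ξ => ?_⟩
    obtain ⟨K, rfl⟩ : ∃ K', K = K' + 1 := ⟨K - 1, by omega⟩
    -- The derivative falls on the polynomial or on the Gaussian; after division by -2πi these are
    -- the two terms of `heatSum_X_mul`, with 2c = 1/(2πt).
    have hd1 := hasDerivAt_fourier_line (integrable_polyVal_mul_gaussian p hb)
      (integrable_norm_mul_norm_polyVal_gaussian p hb) ξ i
    have hd2 := (((hasDerivAt_eval_line (heatSum K (1 / (4 * Real.pi * t)) p) (-Complex.I / t) ξ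
        i).mul
      (hasDerivAt_gaussian_line (Real.pi / t) ξ i))).const_mul ((t ^ (-(n : ℝ) / 2) : ℝ) : ℂ)
    have heq := hd1.unique (hd2.congr_of_eventuallyEq (Eventually.of_forall fun s => by
      simp only [h0 K (by omega), Pi.mul_apply]; ring))
    have hc : (fun x : Rn n => polyVal (p * X i) x * (Real.exp (-(Real.pi * t) * ‖x‖ ^ 2) : ℂ)) =
        fun x : Rn n => (x i : ℂ) *
          (polyVal p x * (Real.exp (-(Real.pi * t) * ‖x‖ ^ 2) : ℂ)) := by
      ext x; simp [polyVal]; ring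
    have hK1 := h0 (K + 1) (by omega) ξ
    rw [h0 K (by omega) ξ] at hK1
    rw [hc, mul_comm p, heatSum_X_mul, map_add, map_mul, eval_X, smul_eval]
    -- The truncations K and K + 1 give the same transform by the induction hypothesis, hence the
    -- same value; no degree bound is involved.
    have hE : eval (fun k => (-Complex.I / t) * (ξ k : ℂ)) (heatSum K (1 / (4 * Real.pi * t)) p) =
        eval (fun k => (-Complex.I / t) * (ξ k : ℂ)) (heatSum (K + 1) (1 / (4 * Real.pi * t)) p)
            := by
      have e1 : ((t ^ (-(n : ℝ) / 2) : ℝ) : ℂ) ≠ 0 := by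
        exact_mod_cast (Real.rpow_pos_of_pos ht _).ne'
      have e2 : ((Real.exp (-(Real.pi / t) * ‖ξ‖ ^ 2) : ℝ) : ℂ) ≠ 0 := by
        exact_mod_cast (Real.exp_pos _).ne'
      exact mul_left_cancel₀ e1 (mul_right_cancel₀ e2 hK1)
    simp only [zero_smul, add_zero] at heq
    rw [← hE]
    have hI : (2 * Real.pi * Complex.I) ≠ 0 := by simp [hpi]
    apply mul_left_cancel₀ (neg_ne_zero.mpr hI)
    rw [heq]
    generalize eval (fun k => (-Complex.I / t) * (ξ k : ℂ))
      (pderiv i (heatSum K (1 / (4 * Real.pi * t)) p)) = A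
    generalize eval (fun k => (-Complex.I / t) * (ξ k : ℂ))
      (heatSum K (1 / (4 * Real.pi * t)) p) = B
    push_cast
    field_simp
    ring_nf
    simp only [Complex.I_sq]
    ring

/-- **Hecke–Bochner identity** for Gaussians. -/
theorem fourier_harmonic_mul_gaussian {P : MvPolynomial (Fin n) ℂ} {j : ℕ} (hj : P.IsHomogeneous j)
    (hP : polyLaplacian n P = 0) {t : ℝ} (ht : 0 < t) (ξ : Rn n) :
    (𝓕 (fun x : Rn n => polyVal P x * (Real.exp (-(Real.pi * t) * ‖x‖ ^ 2) : ℂ))) ξ =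
      (-Complex.I) ^ j * (t ^ (-(n : ℝ) / 2 - j) : ℝ) * polyVal P ξ *
        (Real.exp (-(Real.pi / t) * ‖ξ‖ ^ 2) : ℂ) := by
  obtain ⟨K₀, h⟩ := fourier_polyVal_mul_gaussian P ht
  rw [h (K₀ + 1) (by omega), heatSum_of_polyLaplacian_eq_zero hP, Real.rpow_sub ht,
    Real.rpow_natCast]
  have h2 : eval (fun k => (-Complex.I / t) * (ξ k : ℂ)) P =
      (-Complex.I / t) ^ j * polyVal P ξ := by
    exact eval_mul_of_isHomogeneous hj _ _
  rw [h2, div_pow]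
  push_cast
  ring

end HeckeBochner

/-! ### Truncated superpositions of Gaussians. -/

/-- A truncated superposition of Gaussians, approximating a multiple of `r ^ (-2 a)` on
`exp (-L / 2) < r < exp (L / 2)`. -/
def gaussSup (a L r : ℝ) : ℝ :=
  ∫ τ in (-L)..L, Real.exp (a * τ) * Real.exp (-(Real.pi * Real.exp τ) * r ^ 2)

section GaussSup

theorem continuous_gaussSup (a L : ℝ) : Continuous (gaussSup a L) := by
  unfold gaussSup
  apply intervalIntegral.continuous_parametric_intervalIntegral_of_continuous'
  fun_prop

theorem gaussSup_nonneg {a L : ℝ} (hL : 0 ≤ L) (r : ℝ) : 0 ≤ gaussSup a L r :=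
  intervalIntegral.integral_nonneg (by linarith) fun τ _ => by positivity

/-- Each factor is replaced by its largest value on |τ| ≤ L. The Gaussian of width fixed by -L gives
both the decay of `gaussSup` and the domination for Fubini. -/
theorem gaussSup_integrand_le {a L τ : ℝ} (h1 : -L ≤ τ) (h2 : τ ≤ L) (r : ℝ) :
    Real.exp (a * τ) * Real.exp (-(Real.pi * Real.exp τ) * r ^ 2) ≤
      Real.exp (|a| * L) * Real.exp (-(Real.pi * Real.exp (-L)) * r ^ 2) := by
  have e1 : a * τ ≤ |a| * L := by
    refine (le_abs_self _).trans ?_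
    rw [abs_mul]
    exact mul_le_mul_of_nonneg_left (abs_le.mpr ⟨h1, h2⟩) (abs_nonneg a)
  have e2 : -(Real.pi * Real.exp τ) * r ^ 2 ≤ -(Real.pi * Real.exp (-L)) * r ^ 2 := by
    have : Real.exp (-L) ≤ Real.exp τ := Real.exp_le_exp.mpr h1
    have := mul_le_mul_of_nonneg_left this Real.pi_pos.le
    nlinarith [sq_nonneg r]
  exact mul_le_mul (Real.exp_le_exp.mpr e1) (Real.exp_le_exp.mpr e2) (by positivity) (by positivity)

theorem gaussSup_le {a L : ℝ} (hL : 0 ≤ L) (r : ℝ) :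
    gaussSup a L r ≤ 2 * L * Real.exp (|a| * L) * Real.exp (-(Real.pi * Real.exp (-L)) * r ^
        2) := by
  have h := intervalIntegral.integral_mono_on (a := -L) (b := L) (μ := volume)
    (f := fun τ => Real.exp (a * τ) * Real.exp (-(Real.pi * Real.exp τ) * r ^ 2))
    (g := fun _ => Real.exp (|a| * L) * Real.exp (-(Real.pi * Real.exp (-L)) * r ^ 2))
    (by linarith) (Continuous.intervalIntegrable (by fun_prop) _ _)
    (Continuous.intervalIntegrable (by fun_prop) _ _)
    (fun τ hτ => gaussSup_integrand_le hτ.1 hτ.2 r)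
  rw [intervalIntegral.integral_const, smul_eq_mul] at h
  refine h.trans (le_of_eq ?_)
  ring

variable {n : ℕ}

theorem exists_norm_polyVal_mul_gaussSup_le (P : MvPolynomial (Fin n) ℂ) (a : ℝ) {L : ℝ}
    (hL : 0 ≤ L) : ∃ C b : ℝ, 0 < b ∧ ∀ x : Rn n,
      ‖polyVal P x * (gaussSup a L ‖x‖ : ℂ)‖ ≤ C * Real.exp (-b * ‖x‖ ^ 2) := by
  have hb : 0 < Real.pi * Real.exp (-L) := by positivity
  obtain ⟨C, hC, h⟩ := exists_norm_polyVal_mul_gaussian_le P hb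
  refine ⟨2 * L * Real.exp (|a| * L) * C, _, half_pos hb, fun x => ?_⟩
  rw [norm_mul, Complex.norm_real, Real.norm_of_nonneg (gaussSup_nonneg hL _)]
  calc ‖polyVal P x‖ * gaussSup a L ‖x‖ ≤ ‖polyVal P x‖ *
        (2 * L * Real.exp (|a| * L) * Real.exp (-(Real.pi * Real.exp (-L)) * ‖x‖ ^ 2)) := by
        gcongr; exact gaussSup_le hL _
    _ = 2 * L * Real.exp (|a| * L) *
        (‖polyVal P x‖ * Real.exp (-(Real.pi * Real.exp (-L)) * ‖x‖ ^ 2)) := by ring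
    _ ≤ 2 * L * Real.exp (|a| * L) *
        (C * Real.exp (-(Real.pi * Real.exp (-L) / 2) * ‖x‖ ^ 2)) := by
        gcongr ?_ * ?_; exact h x
    _ = _ := by ring

theorem continuous_polyVal_mul_gaussSup (P : MvPolynomial (Fin n) ℂ) (a L : ℝ) :
    Continuous (fun x : Rn n => polyVal P x * (gaussSup a L ‖x‖ : ℂ)) :=
  (continuous_polyVal P).mul
    (Complex.continuous_ofReal.comp ((continuous_gaussSup a L).comp continuous_norm))

theorem memLp_polyVal_mul_gaussSup (P : MvPolynomial (Fin n) ℂ) (a : ℝ) {L : ℝ} (hL : 0 ≤ L)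
    {p : ℝ≥0∞} (hp : p ≠ 0) (hp' : p ≠ ∞) :
    MemLp (fun x : Rn n => polyVal P x * (gaussSup a L ‖x‖ : ℂ)) p := by
  obtain ⟨C, b, hb, h⟩ := exists_norm_polyVal_mul_gaussSup_le P a hL
  exact memLp_of_norm_le_gaussian (continuous_polyVal_mul_gaussSup P a L).aestronglyMeasurable hb h
    hp hp'

/-- Hecke–Bochner at t = e^τ under the integral sign: the factor t^{-n/2-j} and the reflection τ ↦
-τ turn the exponent a into n/2 + j - a. The interval [-L, L] is symmetric, so the truncation is
preserved exactly. -/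
theorem fourier_harmonic_mul_gaussSup {P : MvPolynomial (Fin n) ℂ} {j : ℕ}
    (hj : P.IsHomogeneous j) (hP : polyLaplacian n P = 0) (a : ℝ) {L : ℝ} (hL : 0 ≤ L)
    (ξ : Rn n) :
    (𝓕 (fun x : Rn n => polyVal P x * (gaussSup a L ‖x‖ : ℂ))) ξ =
      (-Complex.I) ^ j * polyVal P ξ * (gaussSup (n / 2 + j - a) L ‖ξ‖ : ℂ) := by
  have hLL : -L ≤ L := by linarith
  set μ : Measure ℝ := volume.restrict (Set.Ioc (-L) L) with hμ
  have hsup : ∀ b r : ℝ, (gaussSup b L r : ℂ) =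
      ∫ τ, ((Real.exp (b * τ) * Real.exp (-(Real.pi * Real.exp τ) * r ^ 2) : ℝ) : ℂ) ∂μ := by
    intro b r
    rw [gaussSup, intervalIntegral.integral_of_le hLL, ← integral_complex_ofReal]
  let F : Rn n → ℝ → ℂ := fun x τ => (Real.fourierChar (-inner ℝ x ξ) : ℂ) *
    (polyVal P x * ((Real.exp (a * τ) * Real.exp (-(Real.pi * Real.exp τ) * ‖x‖ ^ 2) : ℝ) : ℂ))
  have hF : Integrable (Function.uncurry F) (volume.prod μ) := by
    have hb : 0 < Real.pi * Real.exp (-L) := by positivity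
    have h1 : Integrable (fun z : Rn n × ℝ =>
        ‖polyVal P z.1 * (Real.exp (-(Real.pi * Real.exp (-L)) * ‖z.1‖ ^ 2) : ℂ)‖ *
          Real.exp (|a| * L)) (volume.prod μ) :=
      (integrable_polyVal_mul_gaussian P hb).norm.mul_prod (integrable_const _)
    refine h1.mono' ?_ ?_
    · refine Continuous.aestronglyMeasurable ?_
      have e1 : Continuous fun z : Rn n × ℝ => (Real.fourierChar (-inner ℝ z.1 ξ) : ℂ) :=
        continuous_subtype_val.comp (Real.continuous_fourierChar.comp (by fun_prop))
      have e2 : Continuous fun z : Rn n × ℝ => polyVal P z.1 :=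
        (continuous_polyVal P).comp continuous_fst
      exact e1.mul (e2.mul (by fun_prop))
    · have hmem : ∀ᵐ z : Rn n × ℝ ∂(volume.prod μ), z.2 ∈ Set.Ioc (-L) L :=
        Measure.quasiMeasurePreserving_snd.ae (ae_restrict_mem measurableSet_Ioc)
      filter_upwards [hmem] with z hz
      simp only [Function.uncurry, F]
      rw [norm_mul, Circle.norm_coe, one_mul, norm_mul, norm_mul, Complex.norm_real,
        Complex.norm_real, Real.norm_of_nonneg (by positivity), Real.norm_of_nonneg (by positivity),
        mul_assoc, mul_comm _ (Real.exp (|a| * L))]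
      gcongr ?_ * ?_
      exact gaussSup_integrand_le hz.1.le hz.2 _
  have h1 : (𝓕 (fun x : Rn n => polyVal P x * (gaussSup a L ‖x‖ : ℂ))) ξ = ∫ x, ∫ τ, F x τ ∂μ := by
    rw [Real.fourier_eq]
    refine integral_congr_ae (ae_of_all _ fun x => ?_)
    simp only [F, Circle.smul_def, smul_eq_mul]
    rw [integral_const_mul, integral_const_mul, hsup]
  have h2 : ∀ τ, ∫ x, F x τ = (-Complex.I) ^ j * polyVal P ξ *
      ((Real.exp (-(n / 2 + j - a) * τ) *
        Real.exp (-(Real.pi * Real.exp (-τ)) * ‖ξ‖ ^ 2) : ℝ) : ℂ) := by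
    intro τ
    have h3 := fourier_harmonic_mul_gaussian hj hP (Real.exp_pos τ) ξ
    rw [Real.fourier_eq] at h3
    have h4 : ∫ x, F x τ = (Real.exp (a * τ) : ℂ) * ∫ v : Rn n, Real.fourierChar (-inner ℝ v ξ) •
        (polyVal P v * (Real.exp (-(Real.pi * Real.exp τ) * ‖v‖ ^ 2) : ℂ)) := by
      rw [← integral_const_mul]
      refine integral_congr_ae (ae_of_all _ fun x => ?_)
      simp only [F, Circle.smul_def, smul_eq_mul, Complex.ofReal_mul]
      ring
    rw [h4, h3, ← Real.exp_mul]
    have h5 : Real.exp (-(n / 2 + j - a) * τ) =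
        Real.exp (a * τ) * Real.exp (τ * (-(n : ℝ) / 2 - j)) := by
      rw [← Real.exp_add]; ring_nf
    rw [h5, Real.exp_neg τ, div_eq_mul_inv]
    push_cast
    ring_nf
  rw [h1, integral_integral_swap hF, integral_congr_ae (ae_of_all _ h2), integral_const_mul]
  congr 1
  rw [gaussSup, integral_complex_ofReal, ← intervalIntegral.integral_of_le hLL]
  have h6 := intervalIntegral.integral_comp_neg (a := -L) (b := L)
    (fun τ => Real.exp ((n / 2 + j - a) * τ) * Real.exp (-(Real.pi * Real.exp τ) * ‖ξ‖ ^ 2))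
  rw [neg_neg] at h6
  rw [← h6]
  congr 2
  ext τ
  ring_nf

end GaussSup

/-! ### The radial cut-off and its limit. -/

/-- The density of `log t` under `t ^ a * exp (-π t) dt / t`. -/
def logGamma (a y : ℝ) : ℝ := Real.exp (a * y) * Real.exp (-(Real.pi * Real.exp y))

/-- The radial cut-off: `gaussSup` normalized and written in the logarithmic scale. -/
def cutoff (a L s : ℝ) : ℝ :=
  Real.pi ^ a / Real.Gamma a * (Real.exp (a * (L * s)) * gaussSup a L (Real.exp (L * s / 2)))

section Cutoff

theorem continuous_logGamma (a : ℝ) : Continuous (logGamma a) := by unfold logGamma; fun_prop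

theorem logGamma_nonneg (a y : ℝ) : 0 ≤ logGamma a y := by unfold logGamma; positivity

/-- For y ≤ 0 the decay is that of e^{ay}. For y ≥ 0 the double exponential dominates y², and 2ay ≤
a² + y² produces the constant e^{a²}. -/
theorem exists_logGamma_le (a : ℝ) :
    ∃ C : ℝ, 0 < C ∧ ∀ y, logGamma a y ≤ C * Real.exp (-a * |y|) := by
  refine ⟨Real.exp (a ^ 2), Real.exp_pos _, fun y => ?_⟩
  rw [logGamma, ← Real.exp_add, ← Real.exp_add, Real.exp_le_exp]
  have hpi := Real.pi_gt_three
  rcases le_total 0 y with hy | hy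
  · rw [abs_of_nonneg hy]
    have h1 := Real.quadratic_le_exp_of_nonneg hy
    have h2 : 3 * Real.exp y ≤ Real.pi * Real.exp y := by gcongr
    nlinarith [sq_nonneg (y - a), sq_nonneg y]
  · rw [abs_of_nonpos hy]
    have : 0 ≤ Real.pi * Real.exp y := by positivity
    nlinarith [sq_nonneg a]

theorem integrable_exp_neg_mul_abs {b : ℝ} (hb : 0 < b) :
    Integrable (fun y : ℝ => Real.exp (-b * |y|)) := by
  apply Integrable.of_integral_ne_zero
  rw [integral_comp_abs (f := fun y => Real.exp (-b * y)), integral_exp_mul_Ioi (neg_lt_zero.mpr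
      hb)]
  simp [hb.ne']

theorem integrable_logGamma {a : ℝ} (ha : 0 < a) : Integrable (logGamma a) := by
  obtain ⟨C, hC, h⟩ := exists_logGamma_le a
  refine ((integrable_exp_neg_mul_abs ha).const_mul C).mono'
    (continuous_logGamma a).aestronglyMeasurable (ae_of_all _ fun y => ?_)
  rw [Real.norm_of_nonneg (logGamma_nonneg a y)]
  exact h y

theorem integral_logGamma {a : ℝ} (ha : 0 < a) :
    ∫ y, logGamma a y = Real.Gamma a / Real.pi ^ a := by
  have h1 := Real.integral_rpow_mul_exp_neg_mul_Ioi ha Real.pi_pos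
  have h2 := integral_image_eq_integral_abs_deriv_smul (s := Set.univ) (f := Real.exp)
    (f' := Real.exp) MeasurableSet.univ (fun x _ => (Real.hasDerivAt_exp x).hasDerivWithinAt)
    Real.exp_injective.injOn (fun t => t ^ (a - 1) * Real.exp (-(Real.pi * t)))
  rw [Set.image_univ, Real.range_exp, h1, setIntegral_univ] at h2
  rw [Real.div_rpow zero_le_one Real.pi_pos.le, Real.one_rpow, one_div_mul_eq_div] at h2
  rw [h2]
  refine integral_congr_ae (ae_of_all _ fun y => ?_)
  simp only [logGamma, smul_eq_mul]
  rw [abs_of_pos (Real.exp_pos y), ← Real.exp_mul, ← mul_assoc, ← Real.exp_add y]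
  ring_nf

/-- The shift τ ↦ τ + Ls absorbs r² = e^{Ls}. Thus the cut-off is the mass that a probability
density gives to the window (L(s-1), L(s+1)), which fills the line if |s| < 1 and escapes to
infinity if |s| > 1. -/
theorem cutoff_eq (a : ℝ) (L s : ℝ) :
    cutoff a L s = Real.pi ^ a / Real.Gamma a *
      ∫ y in (L * (s - 1))..(L * (s + 1)), logGamma a y := by
  have h := intervalIntegral.integral_comp_add_right (a := -L) (b := L) (logGamma a) (L * s)
  rw [cutoff, gaussSup, ← intervalIntegral.integral_const_mul]
  congr 1
  rw [show L * (s - 1) = -L + L * s by ring, show L * (s + 1) = L + L * s by ring, ← h]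
  congr 1
  ext τ
  rw [logGamma, ← mul_assoc, ← Real.exp_add, ← Real.exp_nat_mul]
  have : Real.pi * Real.exp (τ + L * s) = Real.pi * Real.exp τ * Real.exp (↑2 * (L * s / 2)) := by
    rw [Real.exp_add]; ring_nf
  rw [this]
  push_cast
  ring_nf

theorem cutoff_nonneg {a L : ℝ} (ha : 0 < a) (hL : 0 ≤ L) (s : ℝ) : 0 ≤ cutoff a L s := by
  have := Real.Gamma_pos_of_pos ha
  have := gaussSup_nonneg (a := a) hL (Real.exp (L * s / 2))
  unfold cutoff
  positivity

theorem continuous_cutoff (a L : ℝ) : Continuous (cutoff a L) := by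
  unfold cutoff
  have := continuous_gaussSup a L
  fun_prop

/-- Every y in the window has |y| ≥ L(|s| - 1). Half of the decay of `logGamma` yields the stated
factor and the other half keeps the integral finite. -/
theorem exists_cutoff_le {a : ℝ} (ha : 0 < a) :
    ∃ C : ℝ, 0 < C ∧ ∀ L s : ℝ, 0 ≤ L → 1 ≤ |s| →
      cutoff a L s ≤ C * Real.exp (-(a / 2) * (L * (|s| - 1))) := by
  obtain ⟨C, hC, h⟩ := exists_logGamma_le a
  have hG := Real.Gamma_pos_of_pos ha
  have hI := integrable_exp_neg_mul_abs (half_pos ha)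
  have hI0 : 0 ≤ ∫ y : ℝ, Real.exp (-(a / 2) * |y|) := integral_nonneg fun y => (Real.exp_nonneg _)
  refine ⟨Real.pi ^ a / Real.Gamma a * (C * ∫ y : ℝ, Real.exp (-(a / 2) * |y|)) + 1,
    by positivity, fun L s hL hs => ?_⟩
  have hle : L * (s - 1) ≤ L * (s + 1) := by nlinarith
  have key : ∫ y in (L * (s - 1))..(L * (s + 1)), logGamma a y ≤
      (C * ∫ y : ℝ, Real.exp (-(a / 2) * |y|)) * Real.exp (-(a / 2) * (L * (|s| - 1))) := by
    rw [intervalIntegral.integral_of_le hle]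
    calc ∫ y in Set.Ioc (L * (s - 1)) (L * (s + 1)), logGamma a y
        ≤ ∫ y in Set.Ioc (L * (s - 1)) (L * (s + 1)),
            C * Real.exp (-(a / 2) * |y|) * Real.exp (-(a / 2) * (L * (|s| - 1))) := by
          refine setIntegral_mono_on (integrable_logGamma ha).integrableOn
            ((hI.const_mul C).mul_const _).integrableOn measurableSet_Ioc fun y hy => ?_
          refine (h y).trans ?_
          rw [mul_assoc, ← Real.exp_add]
          refine mul_le_mul_of_nonneg_left (Real.exp_le_exp.mpr ?_) hC.le
          have : L * (|s| - 1) ≤ |y| := by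
            rcases abs_cases s with ⟨e, _⟩ | ⟨e, _⟩ <;> rw [e] <;>
              rcases abs_cases y with ⟨e', _⟩ | ⟨e', _⟩ <;> rw [e'] <;> nlinarith [hy.1, hy.2]
          nlinarith
      _ ≤ ∫ y, C * Real.exp (-(a / 2) * |y|) * Real.exp (-(a / 2) * (L * (|s| - 1))) :=
          setIntegral_le_integral ((hI.const_mul C).mul_const _)
            (ae_of_all _ fun y => by simp only [Pi.zero_apply]; positivity)
      _ = _ := by rw [integral_mul_const, integral_const_mul]
  rw [cutoff_eq]
  have hpos : 0 ≤ Real.pi ^ a / Real.Gamma a := by positivity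
  have h1 := mul_le_mul_of_nonneg_left key hpos
  rw [← mul_assoc] at h1
  refine h1.trans ?_
  gcongr
  linarith

theorem cutoff_le_one {a L : ℝ} (ha : 0 < a) (hL : 0 ≤ L) (s : ℝ) : cutoff a L s ≤ 1 := by
  have hG := Real.Gamma_pos_of_pos ha
  have hle : L * (s - 1) ≤ L * (s + 1) := by nlinarith
  rw [cutoff_eq, intervalIntegral.integral_of_le hle]
  have h1 := setIntegral_le_integral (s := Set.Ioc (L * (s - 1)) (L * (s + 1)))
    (integrable_logGamma ha) (ae_of_all _ (logGamma_nonneg a))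
  rw [integral_logGamma ha] at h1
  calc _ ≤ Real.pi ^ a / Real.Gamma a * (Real.Gamma a / Real.pi ^ a) := by gcongr
    _ = 1 := by
      have : Real.pi ^ a ≠ 0 := (Real.rpow_pos_of_pos Real.pi_pos a).ne'
      field_simp

/-- The bound is free of L, as dominated convergence requires; for |s| ≤ 1 it follows from
`cutoff_le_one`. -/
theorem exists_cutoff_le_exp {a : ℝ} (ha : 0 < a) :
    ∃ C : ℝ, 0 < C ∧ ∀ L s : ℝ, 1 ≤ L → cutoff a L s ≤ C * Real.exp (-(a / 2) * |s|) := by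
  obtain ⟨C, hC, h⟩ := exists_cutoff_le ha
  refine ⟨(C + 1) * Real.exp (a / 2), by positivity, fun L s hL => ?_⟩
  rw [mul_assoc, ← Real.exp_add]
  rcases le_total 1 |s| with hs | hs
  · refine (h L s (by linarith) hs).trans (mul_le_mul (by linarith) ?_ (by positivity)
      (by positivity))
    apply Real.exp_le_exp.mpr
    nlinarith [mul_nonneg (sub_nonneg.mpr hL) (sub_nonneg.mpr hs)]
  · refine (cutoff_le_one ha (by linarith) s).trans ?_
    have : 1 ≤ Real.exp (a / 2 + -(a / 2) * |s|) := Real.one_le_exp (by nlinarith)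
    nlinarith

/-- The limit of the cut-offs, away from `|s| = 1`. -/
def cutoffLimit (s : ℝ) : ℝ := Set.indicator (Set.Ioo (-1) 1) (fun _ => (1 : ℝ)) s

/-- At |s| = 1 the window grows to a half-line ending at 0 and the limit is only part of the mass;
these two points form a null set. -/
theorem tendsto_cutoff {a : ℝ} (ha : 0 < a) {s : ℝ} (hs : |s| ≠ 1) :
    Tendsto (fun L => cutoff a L s) atTop (𝓝 (cutoffLimit s)) := by
  rcases lt_or_gt_of_ne hs with h | h
  · have hs' := abs_lt.mp h
    rw [cutoffLimit, Set.indicator_of_mem (show s ∈ Set.Ioo (-1 : ℝ) 1 from hs')]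
    have h1 := intervalIntegral_tendsto_integral (integrable_logGamma ha)
      (tendsto_id.atTop_mul_const_of_neg (show s - 1 < 0 by linarith))
      (tendsto_id.atTop_mul_const (show 0 < s + 1 by linarith))
    have h2 := h1.const_mul (Real.pi ^ a / Real.Gamma a)
    rw [integral_logGamma ha] at h2
    have hG := (Real.Gamma_pos_of_pos ha).ne'
    have : Real.pi ^ a ≠ 0 := (Real.rpow_pos_of_pos Real.pi_pos a).ne'
    rw [div_mul_div_cancel₀ hG, div_self this] at h2
    simpa only [cutoff_eq, id] using h2
  · have hnot : s ∉ Set.Ioo (-1 : ℝ) 1 := fun hm => by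
      have := abs_lt.mpr hm; linarith
    rw [cutoffLimit, Set.indicator_of_notMem hnot]
    obtain ⟨C, hC, hb⟩ := exists_cutoff_le ha
    have hlim : Tendsto (fun L => C * Real.exp (-(a / 2) * (L * (|s| - 1)))) atTop (𝓝 0) := by
      rw [← mul_zero C]
      refine Tendsto.const_mul C (Real.tendsto_exp_atBot.comp ?_)
      have : -(a / 2) < 0 := by linarith
      exact (tendsto_id.atTop_mul_const (show 0 < |s| - 1 by linarith)).const_mul_atTop_of_neg this
    refine tendsto_of_tendsto_of_tendsto_of_le_of_le' tendsto_const_nhds hlim ?_ ?_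
    · filter_upwards [eventually_ge_atTop 0] with L hL using cutoff_nonneg ha hL s
    · filter_upwards [eventually_ge_atTop 0] with L hL using hb L s hL h.le

end Cutoff

/-! ### Polar coordinates with logarithmic radius. -/

section Polar

variable {n : ℕ}

/-- Polar coordinates with logarithmic radius. -/
def logPolar (n : ℕ) (L : ℝ) (z : Sph n × ℝ) : Rn n := Real.exp (L * z.2 / 2) • (z.1 : Rn n)

/-- The Jacobian of `logPolar`. -/
def logPolarDensity (n : ℕ) (L : ℝ) (z : Sph n × ℝ) : ℝ := L / 2 * Real.exp (n * (L * z.2 / 2))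

theorem continuous_logPolar (L : ℝ) : Continuous (logPolar n L) := by
  unfold logPolar; fun_prop

theorem continuous_logPolarDensity (L : ℝ) : Continuous (logPolarDensity n L) := by
  unfold logPolarDensity; fun_prop

theorem norm_logPolar (L : ℝ) (z : Sph n × ℝ) : ‖logPolar n L z‖ = Real.exp (L * z.2 / 2) := by
  rw [logPolar, norm_smul, Real.norm_of_nonneg (Real.exp_nonneg _)]
  simp

theorem lintegral_volumeIoiPow (k : ℕ) (f : ℝ → ℝ≥0∞) (hf : Measurable f) :
    ∫⁻ r : Set.Ioi (0 : ℝ), f r ∂(Measure.volumeIoiPow k) =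
      ∫⁻ r in Set.Ioi (0 : ℝ), ENNReal.ofReal (r ^ k) * f r := by
  have h1 : Measurable fun r : Set.Ioi (0 : ℝ) => ENNReal.ofReal ((r : ℝ) ^ k) := by fun_prop
  have h2 : Measurable fun r : Set.Ioi (0 : ℝ) => f r := hf.comp measurable_subtype_coe
  rw [Measure.volumeIoiPow, lintegral_withDensity_eq_lintegral_mul _ h1 h2]
  exact lintegral_subtype_comap measurableSet_Ioi (fun r : ℝ => ENNReal.ofReal (r ^ k) * f r)

theorem lintegral_Ioi_eq_lintegral_exp {L : ℝ} (hL : 0 < L) (f : ℝ → ℝ≥0∞) :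
    ∫⁻ r in Set.Ioi (0 : ℝ), f r =
      ∫⁻ s, ENNReal.ofReal (L / 2 * Real.exp (L * s / 2)) * f (Real.exp (L * s / 2)) := by
  have hd : ∀ s : ℝ, HasDerivAt (fun s => Real.exp (L * s / 2)) (L / 2 * Real.exp (L * s / 2)) s
      := by
    intro s
    have h1 : HasDerivAt (fun s : ℝ => L * s / 2) (L / 2) s := by
      simpa using ((hasDerivAt_id s).const_mul L).div_const 2
    simpa [mul_comm] using h1.exp
  have hinj : Function.Injective (fun s => Real.exp (L * s / 2)) := by
    intro s t h
    have := Real.exp_injective h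
    have : L * s = L * t := by linarith
    exact mul_left_cancel₀ hL.ne' this
  have himg : (fun s => Real.exp (L * s / 2)) '' Set.univ = Set.Ioi 0 := by
    ext r
    simp only [Set.image_univ, Set.mem_range, Set.mem_Ioi]
    constructor
    · rintro ⟨s, rfl⟩; exact Real.exp_pos _
    · intro hr
      refine ⟨2 * Real.log r / L, ?_⟩
      rw [show L * (2 * Real.log r / L) / 2 = Real.log r by field_simp, Real.exp_log hr]
  have h := lintegral_image_eq_lintegral_abs_deriv_mul (s := Set.univ) MeasurableSet.univ
    (fun s _ => (hd s).hasDerivWithinAt) hinj.injOn f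
  rw [himg, setLIntegral_univ] at h
  rw [h]
  refine lintegral_congr fun s => ?_
  rw [abs_of_pos (by positivity)]

/-- With r = e^{Ls/2} the measure r^{n-1} dr becomes (L/2) r^n ds. The scale L/2 is the one that
moves the edge of the truncation to |s| = 1. -/
theorem lintegral_eq_lintegral_logPolar [NeZero n] {L : ℝ} (hL : 0 < L) {F : Rn n → ℝ≥0∞}
    (hF : Measurable F) :
    ∫⁻ x, F x = ∫⁻ z, ENNReal.ofReal (logPolarDensity n L z) * F (logPolar n L z)
      ∂((surf n).prod volume) := by
  have : Nontrivial (Rn n) := by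
    have : Nonempty (Fin n) := ⟨0⟩
    infer_instance
  have hmp := (volume : Measure (Rn n)).measurePreserving_homeomorphUnitSphereProd
  let G : Sph n × Set.Ioi (0 : ℝ) → ℝ≥0∞ := fun y => F ((y.2 : ℝ) • (y.1 : Rn n))
  have hG : Measurable G := hF.comp (by fun_prop)
  have h1 : ∫⁻ x, F x = ∫⁻ y, G y ∂((surf n).prod (Measure.volumeIoiPow (n - 1))) := by
    have e1 : ∫⁻ x, F x = ∫⁻ x in ({0}ᶜ : Set (Rn n)), F x := by
      rw [restrict_compl_singleton]
    rw [e1, ← lintegral_subtype_comap (measurableSet_singleton (0 : Rn n)).compl]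
    have e2 := hmp.lintegral_comp hG
    rw [finrank_euclideanSpace_fin] at e2
    rw [← e2]
    refine lintegral_congr fun x => ?_
    simp only [G]
    congr 1
    have hx : ‖(x : Rn n)‖ ≠ 0 := norm_ne_zero_iff.mpr x.2
    simp [smul_smul, hx]
  rw [h1, lintegral_prod _ hG.aemeasurable, lintegral_prod]
  · refine lintegral_congr fun ω => ?_
    rw [lintegral_volumeIoiPow (n - 1) (fun r : ℝ => F (r • (ω : Rn n))) (hF.comp (by fun_prop)),
      lintegral_Ioi_eq_lintegral_exp hL]
    refine lintegral_congr fun s => ?_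
    simp only [logPolar, logPolarDensity]
    rw [← mul_assoc, ← ENNReal.ofReal_mul (by positivity), mul_assoc, ← pow_succ',
      Nat.sub_add_cancel (Nat.pos_of_ne_zero (NeZero.ne n)), ← Real.exp_nat_mul]
  · exact ((ENNReal.measurable_ofReal.comp (continuous_logPolarDensity L).measurable).mul
      (hF.comp (continuous_logPolar L).measurable)).aemeasurable

theorem volume_eq_map_logPolar [NeZero n] {L : ℝ} (hL : 0 < L) :
    (volume : Measure (Rn n)) = (((surf n).prod volume).withDensity
      fun z => ENNReal.ofReal (logPolarDensity n L z)).map (logPolar n L) := by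
  ext s hs
  have hΦ := (continuous_logPolar (n := n) L).measurable
  rw [Measure.map_apply hΦ hs, withDensity_apply _ (hΦ hs), ← lintegral_indicator_one hs,
    lintegral_eq_lintegral_logPolar hL (measurable_one.indicator hs),
    ← lintegral_indicator (hΦ hs)]
  refine lintegral_congr fun z => ?_
  by_cases h : logPolar n L z ∈ s
  · rw [Set.indicator_of_mem h, Set.indicator_of_mem (show z ∈ logPolar n L ⁻¹' s from h)]
    simp
  · rw [Set.indicator_of_notMem h,
      Set.indicator_of_notMem (show z ∉ logPolar n L ⁻¹' s from h), mul_zero]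

theorem integral_eq_integral_logPolar [NeZero n] {L : ℝ} (hL : 0 < L) {F : Rn n → ℂ}
    (hF : Measurable F) :
    ∫ x, F x = ∫ z, logPolarDensity n L z • F (logPolar n L z) ∂((surf n).prod volume) := by
  conv_lhs => rw [volume_eq_map_logPolar hL]
  have h1 : Measurable fun z => ENNReal.ofReal (logPolarDensity n L z) :=
    ENNReal.measurable_ofReal.comp (continuous_logPolarDensity L).measurable
  rw [integral_map (continuous_logPolar L).measurable.aemeasurable hF.aestronglyMeasurable,
    integral_withDensity_eq_integral_toReal_smul h1 (ae_of_all _ fun z => ENNReal.ofReal_lt_top)]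
  refine integral_congr_ae (ae_of_all _ fun z => ?_)
  simp only
  rw [ENNReal.toReal_ofReal (by unfold logPolarDensity; positivity)]

end Polar

/-! ### Limits of cut-off sums as L → ∞. -/

section SphereAsymptotics

variable {n : ℕ}

/-- A finite sum of functions on the sphere multiplied by radial cut-offs. -/
def cutoffSum (J : ℕ) (A : ℕ → Sph n → ℂ) (a : ℕ → ℝ) (L : ℝ) (z : Sph n × ℝ) : ℂ :=
  ∑ j ∈ Finset.range J, A j z.1 * (cutoff (a j) L z.2 : ℂ)

theorem continuous_cutoffSum (J : ℕ) {A : ℕ → Sph n → ℂ} (a : ℕ → ℝ) (hA : ∀ j, Continuous (A j))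
    (L : ℝ) : Continuous (cutoffSum J A a L) := by
  unfold cutoffSum
  refine continuous_finsetSum _ fun j _ => ?_
  exact ((hA j).comp continuous_fst).mul
    (Complex.continuous_ofReal.comp ((continuous_cutoff _ _).comp continuous_snd))

/-- The integrable majorant for both limits below: finitely many profiles, bounded on the compact
sphere, with δ the smallest of the decay rates. -/
theorem exists_norm_cutoffSum_le (J : ℕ) {A : ℕ → Sph n → ℂ} {a : ℕ → ℝ} (ha : ∀ j, 0 < a j)
    (hA : ∀ j, Continuous (A j)) :
    ∃ C δ : ℝ, 0 < C ∧ 0 < δ ∧ ∀ L, 1 ≤ L → ∀ z,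
      ‖cutoffSum J A a L z‖ ≤ C * Real.exp (-δ * |z.2|) := by
  induction J with
  | zero => exact ⟨1, 1, one_pos, one_pos, fun L _ z => by simp [cutoffSum]; positivity⟩
  | succ J ih =>
    obtain ⟨C, δ, hC, hδ, h⟩ := ih
    obtain ⟨D, hD, h'⟩ := exists_cutoff_le_exp (ha J)
    obtain ⟨B, hB⟩ := (isCompact_univ (X := Sph n)).exists_bound_of_continuousOn
      (hA J).continuousOn
    have haJ := ha J
    refine ⟨C + |B| * D, min δ (a J / 2), by positivity, by positivity, fun L hL z => ?_⟩
    rw [cutoffSum, Finset.sum_range_succ, add_mul]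
    refine (norm_add_le _ _).trans (add_le_add ?_ ?_)
    · refine (h L hL z).trans (mul_le_mul_of_nonneg_left (Real.exp_le_exp.mpr ?_) hC.le)
      exact mul_le_mul_of_nonneg_right (neg_le_neg (min_le_left _ _)) (abs_nonneg _)
    · rw [norm_mul, Complex.norm_real, Real.norm_of_nonneg (cutoff_nonneg haJ (by linarith) _),
        mul_assoc]
      refine mul_le_mul ((hB _ (Set.mem_univ _)).trans (le_abs_self B)) ((h' L z.2 hL).trans ?_)
        (cutoff_nonneg haJ (by linarith) _) (abs_nonneg B)
      refine mul_le_mul_of_nonneg_left (Real.exp_le_exp.mpr ?_) hD.le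
      exact mul_le_mul_of_nonneg_right (neg_le_neg (min_le_right _ _)) (abs_nonneg _)

theorem tendsto_cutoffSum (J : ℕ) (A : ℕ → Sph n → ℂ) {a : ℕ → ℝ} (ha : ∀ j, 0 < a j)
    {z : Sph n × ℝ} (hz : |z.2| ≠ 1) :
    Tendsto (fun L => cutoffSum J A a L z) atTop
      (𝓝 ((∑ j ∈ Finset.range J, A j z.1) * (cutoffLimit z.2 : ℂ))) := by
  unfold cutoffSum
  rw [Finset.sum_mul]
  refine tendsto_finsetSum _ fun j _ => ?_
  exact ((Complex.continuous_ofReal.tendsto _).comp (tendsto_cutoff (ha j) hz)).const_mul _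

theorem ae_abs_snd_ne_one : ∀ᵐ z : Sph n × ℝ ∂((surf n).prod volume), |z.2| ≠ 1 := by
  have h : ∀ᵐ s : ℝ, |s| ≠ 1 := by
    have : ({1, -1} : Set ℝ)ᶜ ∈ ae (volume : Measure ℝ) :=
      compl_mem_ae_iff.mpr ((Set.toFinite _).measure_zero _)
    filter_upwards [this] with s hs h
    rcases (abs_eq zero_le_one).mp h with h | h <;> simp [h] at hs
  exact Measure.quasiMeasurePreserving_snd.ae h

theorem integrable_exp_snd {b : ℝ} (hb : 0 < b) :
    Integrable (fun z : Sph n × ℝ => Real.exp (-b * |z.2|)) ((surf n).prod volume) := by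
  have := (integrable_const (1 : ℝ) (μ := surf n)).mul_prod (integrable_exp_neg_mul_abs hb)
  simpa using this

/-- Dominated convergence; the factor 2 is the length of (-1, 1). -/
theorem tendsto_lintegral_cutoffSum (J : ℕ) {A : ℕ → Sph n → ℂ} {a : ℕ → ℝ}
    (ha : ∀ j, 0 < a j) (hA : ∀ j, Continuous (A j)) {r : ℝ} (hr : 0 < r) :
    Tendsto (fun L => ∫⁻ z, ‖cutoffSum J A a L z‖ₑ ^ r ∂((surf n).prod volume)) atTop
      (𝓝 (2 * ∫⁻ ω, ‖∑ j ∈ Finset.range J, A j ω‖ₑ ^ r ∂(surf n))) := by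
  obtain ⟨C, δ, hC, hδ, hb⟩ := exists_norm_cutoffSum_le J ha hA
  have hlim : ∫⁻ z : Sph n × ℝ, ‖(∑ j ∈ Finset.range J, A j z.1) * (cutoffLimit z.2 : ℂ)‖ₑ ^ r
      ∂((surf n).prod volume) = 2 * ∫⁻ ω, ‖∑ j ∈ Finset.range J, A j ω‖ₑ ^ r ∂(surf n) := by
    have hcont : Continuous fun ω => ∑ j ∈ Finset.range J, A j ω :=
      continuous_finsetSum _ fun j _ => hA j
    have e1 : ∀ s : ℝ, ‖(cutoffLimit s : ℂ)‖ₑ ^ r = Set.indicator (Set.Ioo (-1) 1) 1 s := by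
      intro s
      rw [cutoffLimit]
      by_cases hs : s ∈ Set.Ioo (-1 : ℝ) 1
      · rw [Set.indicator_of_mem hs, Set.indicator_of_mem hs]; simp
      · rw [Set.indicator_of_notMem hs, Set.indicator_of_notMem hs]; simp [hr]
    simp_rw [enorm_mul, ENNReal.mul_rpow_of_nonneg _ _ hr.le, e1]
    rw [lintegral_prod_mul (f := fun ω => ‖∑ j ∈ Finset.range J, A j ω‖ₑ ^ r)
      (g := Set.indicator (Set.Ioo (-1 : ℝ) 1) 1) (hcont.enorm.measurable.pow_const r).aemeasurable
      (measurable_one.indicator measurableSet_Ioo).aemeasurable,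
      lintegral_indicator_one measurableSet_Ioo, Real.volume_Ioo, mul_comm]
    norm_num
  rw [← hlim]
  refine tendsto_lintegral_filter_of_dominated_convergence
    (fun z => ENNReal.ofReal (C ^ r * Real.exp (-(δ * r) * |z.2|))) ?_ ?_ ?_ ?_
  · exact Eventually.of_forall fun L =>
      ((continuous_cutoffSum J a hA L).enorm.measurable.pow_const r)
  · filter_upwards [eventually_ge_atTop 1] with L hL
    refine ae_of_all _ fun z => ?_
    rw [← ofReal_norm, ENNReal.ofReal_rpow_of_nonneg (norm_nonneg _) hr.le]
    apply ENNReal.ofReal_le_ofReal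
    calc _ ≤ (C * Real.exp (-δ * |z.2|)) ^ r :=
          Real.rpow_le_rpow (norm_nonneg _) (hb L hL z) hr.le
      _ = _ := by
        rw [Real.mul_rpow hC.le (Real.exp_nonneg _), ← Real.exp_mul]
        ring_nf
  · exact ((integrable_exp_snd (n := n) (mul_pos hδ hr)).const_mul (C ^ r)).lintegral_lt_top.ne
  · filter_upwards [ae_abs_snd_ne_one] with z hz
    exact (ENNReal.continuous_rpow_const.tendsto _).comp
      ((continuous_enorm.tendsto _).comp (tendsto_cutoffSum J A ha hz))

/-- The cut-offs of the two sums have different exponents but one common limit, an indicator equal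
to its own square; hence again the factor 2. -/
theorem tendsto_integral_cutoffSum (J J' : ℕ) {A A' : ℕ → Sph n → ℂ} {a a' : ℕ → ℝ}
    (ha : ∀ j, 0 < a j) (hA : ∀ j, Continuous (A j))
    (ha' : ∀ j, 0 < a' j) (hA' : ∀ j, Continuous (A' j)) (m : HomSymbol n) :
    Tendsto (fun L => ∫ z, m.toFun (z.1 : Rn n) * cutoffSum J A a L z *
        (starRingEnd ℂ) (cutoffSum J' A' a' L z) ∂((surf n).prod volume)) atTop
      (𝓝 (2 * ∫ ω, m.toFun (ω : Rn n) * (∑ j ∈ Finset.range J, A j ω) *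
        (starRingEnd ℂ) (∑ j ∈ Finset.range J', A' j ω) ∂(surf n))) := by
  obtain ⟨C, δ, hC, hδ, hb⟩ := exists_norm_cutoffSum_le J ha hA
  obtain ⟨C', δ', hC', hδ', hb'⟩ := exists_norm_cutoffSum_le J' ha' hA'
  obtain ⟨M, hM, hm⟩ := m.exists_norm_le
  have hmm : Measurable fun z : Sph n × ℝ => m.toFun (z.1 : Rn n) :=
    m.measurable'.comp (measurable_subtype_coe.comp measurable_fst)
  have hlim : ∫ z : Sph n × ℝ, m.toFun (z.1 : Rn n) *
        ((∑ j ∈ Finset.range J, A j z.1) * (cutoffLimit z.2 : ℂ)) *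
        (starRingEnd ℂ) ((∑ j ∈ Finset.range J', A' j z.1) * (cutoffLimit z.2 : ℂ))
      ∂((surf n).prod volume) = 2 * ∫ ω, m.toFun (ω : Rn n) * (∑ j ∈ Finset.range J, A j ω) *
        (starRingEnd ℂ) (∑ j ∈ Finset.range J', A' j ω) ∂(surf n) := by
    have e1 : ∀ z : Sph n × ℝ, m.toFun (z.1 : Rn n) *
        ((∑ j ∈ Finset.range J, A j z.1) * (cutoffLimit z.2 : ℂ)) *
        (starRingEnd ℂ) ((∑ j ∈ Finset.range J', A' j z.1) * (cutoffLimit z.2 : ℂ)) =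
        (m.toFun (z.1 : Rn n) * (∑ j ∈ Finset.range J, A j z.1) *
        (starRingEnd ℂ) (∑ j ∈ Finset.range J', A' j z.1)) * (cutoffLimit z.2 : ℂ) := by
      intro z
      have : (cutoffLimit z.2 : ℂ) * cutoffLimit z.2 = cutoffLimit z.2 := by
        rw [cutoffLimit]
        by_cases hs : z.2 ∈ Set.Ioo (-1 : ℝ) 1
        · rw [Set.indicator_of_mem hs]; simp
        · rw [Set.indicator_of_notMem hs]; simp
      rw [map_mul, Complex.conj_ofReal]
      calc _ = (m.toFun (z.1 : Rn n) * (∑ j ∈ Finset.range J, A j z.1) *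
        (starRingEnd ℂ) (∑ j ∈ Finset.range J', A' j z.1)) *
          ((cutoffLimit z.2 : ℂ) * cutoffLimit z.2) := by ring
        _ = _ := by rw [this]
    simp_rw [e1]
    rw [integral_prod_mul (fun ω : Sph n => m.toFun (ω : Rn n) * (∑ j ∈ Finset.range J, A j ω) *
        (starRingEnd ℂ) (∑ j ∈ Finset.range J', A' j ω)) (fun s => (cutoffLimit s : ℂ)),
      integral_complex_ofReal]
    have e2 : ∫ s, cutoffLimit s = 2 := by
      unfold cutoffLimit
      rw [integral_indicator measurableSet_Ioo]
      simp
      norm_num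
    rw [e2, mul_comm]
    norm_num
  rw [← hlim]
  refine tendsto_integral_filter_of_dominated_convergence
    (fun z => M * C * C' * Real.exp (-(δ + δ') * |z.2|)) ?_ ?_ ?_ ?_
  · refine Eventually.of_forall fun L => ?_
    exact (hmm.aestronglyMeasurable.mul (continuous_cutoffSum J a hA L).aestronglyMeasurable).mul
      (Complex.continuous_conj.comp (continuous_cutoffSum J' a' hA' L)).aestronglyMeasurable
  · filter_upwards [eventually_ge_atTop 1] with L hL
    refine ae_of_all _ fun z => ?_
    rw [norm_mul, norm_mul, RCLike.norm_conj]
    calc _ ≤ M * (C * Real.exp (-δ * |z.2|)) * (C' * Real.exp (-δ' * |z.2|)) := by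
          gcongr
          · exact hm _
          · exact hb L hL z
          · exact hb' L hL z
      _ = M * C * C' * (Real.exp (-δ * |z.2|) * Real.exp (-δ' * |z.2|)) := by ring
      _ = _ := by rw [← Real.exp_add]; ring_nf
  · exact (integrable_exp_snd (n := n) (add_pos hδ hδ')).const_mul _
  · filter_upwards [ae_abs_snd_ne_one] with z hz
    exact ((tendsto_cutoffSum J A ha hz).const_mul _).mul
      ((Complex.continuous_conj.tendsto _).comp (tendsto_cutoffSum J' A' ha' hz))

end SphereAsymptotics

/-! ### Test functions and the bound for finite sums. -/

section TestFunctions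

variable {n : ℕ}

/-- A superposition of Gaussians times harmonic polynomials, approximating a function homogeneous
of degree `-β`. -/
def testFn (J : ℕ) (P : ℕ → MvPolynomial (Fin n) ℂ) (d : ℕ → ℂ) (β L : ℝ) (x : Rn n) : ℂ :=
  ∑ j ∈ Finset.range J, d j * (polyVal (P j) x * (gaussSup ((j + β) / 2) L ‖x‖ : ℂ))

/-- The profile on the sphere of the `j`-th summand of `testFn`. -/
def testProfile (P : ℕ → MvPolynomial (Fin n) ℂ) (d : ℕ → ℂ) (β : ℝ) (j : ℕ) (ω : Sph n) : ℂ :=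
  d j * (Real.Gamma ((j + β) / 2) / Real.pi ^ ((j + β) / 2) : ℝ) * polyVal (P j) (ω : Rn n)

theorem continuous_testFn (J : ℕ) (P : ℕ → MvPolynomial (Fin n) ℂ) (d : ℕ → ℂ) (β L : ℝ) :
    Continuous (testFn J P d β L) :=
  continuous_finsetSum _ fun j _ => (continuous_polyVal_mul_gaussSup (P j) _ L).const_mul (d j)

theorem continuous_testProfile (P : ℕ → MvPolynomial (Fin n) ℂ) (d : ℕ → ℂ) (β : ℝ) (j : ℕ) :
    Continuous (testProfile P d β j) :=
  ((continuous_polyVal (P j)).comp continuous_subtype_val).const_mul _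

theorem memLp_testFn (J : ℕ) (P : ℕ → MvPolynomial (Fin n) ℂ) (d : ℕ → ℂ) (β : ℝ) {L : ℝ}
    (hL : 0 ≤ L) {p : ℝ≥0∞} (hp : p ≠ 0) (hp' : p ≠ ∞) : MemLp (testFn J P d β L) p :=
  memLp_finsetSum _ fun j _ => (memLp_polyVal_mul_gaussSup (P j) _ hL hp hp').const_mul (d j)

/-- For a = (j + β)/2 one has n/2 + j - a = (j + n - β)/2, so in every degree j the transform
replaces β by n - β. -/
theorem fourier_testFn (J : ℕ) {P : ℕ → MvPolynomial (Fin n) ℂ}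
    (hj : ∀ j, (P j).IsHomogeneous j) (hP : ∀ j, polyLaplacian n (P j) = 0) (d : ℕ → ℂ) (β : ℝ)
    {L : ℝ} (hL : 0 ≤ L) :
    𝓕 (testFn J P d β L) = testFn J P (fun j => (-Complex.I) ^ j * d j) (n - β) L := by
  ext ξ
  rw [Real.fourier_eq]
  simp only [testFn, Finset.smul_sum]
  rw [integral_finsetSum]
  · refine Finset.sum_congr rfl fun j _ => ?_
    have h := fourier_harmonic_mul_gaussSup (hj j) (hP j) ((j + β) / 2) hL ξ
    rw [Real.fourier_eq] at h
    have e : ((n : ℝ) / 2 + j - (j + β) / 2) = (j + (n - β)) / 2 := by ring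
    rw [e] at h
    trans d j * ∫ v : Rn n, Real.fourierChar (-inner ℝ v ξ) •
      (polyVal (P j) v * (gaussSup ((j + β) / 2) L ‖v‖ : ℂ))
    · rw [← integral_const_mul]
      refine integral_congr_ae (ae_of_all _ fun v => ?_)
      simp only [Circle.smul_def, smul_eq_mul]
      ring
    · rw [h]; ring
  · intro j _
    refine (Real.fourierIntegral_convergent_iff ξ).2 ?_
    rw [← memLp_one_iff_integrable]
    exact (memLp_polyVal_mul_gaussSup (P j) _ hL one_ne_zero ENNReal.one_ne_top).const_mul (d j)

/-- The polynomial gives r^j and the superposition r^{-(j+β)} times a cut-off, so the power left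
over is r^{-β} for every degree. -/
theorem testFn_logPolar (J : ℕ) {P : ℕ → MvPolynomial (Fin n) ℂ}
    (hj : ∀ j, (P j).IsHomogeneous j) (d : ℕ → ℂ) {β : ℝ} (hβ : 0 < β) (L : ℝ) (z : Sph n × ℝ) :
    testFn J P d β L (logPolar n L z) = (Real.exp (-(β * (L * z.2 / 2))) : ℂ) *
      cutoffSum J (testProfile P d β) (fun j => (j + β) / 2) L z := by
  rw [testFn, cutoffSum, Finset.mul_sum]
  refine Finset.sum_congr rfl fun j _ => ?_
  have hG : (Real.Gamma ((j + β) / 2) : ℂ) ≠ 0 := by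
    exact_mod_cast (Real.Gamma_pos_of_pos (by positivity)).ne'
  have hpi : ((Real.pi ^ ((j + β) / 2) : ℝ) : ℂ) ≠ 0 := by
    exact_mod_cast (Real.rpow_pos_of_pos Real.pi_pos _).ne'
  rw [norm_logPolar, logPolar, polyVal_smul (hj j), cutoff, testProfile]
  have e : Real.exp (L * z.2 / 2) ^ j =
      Real.exp (-(β * (L * z.2 / 2))) * Real.exp ((j + β) / 2 * (L * z.2)) := by
    rw [← Real.exp_nat_mul, ← Real.exp_add]
    congr 1
    ring
  rw [← Complex.ofReal_pow, e]
  simp only [Complex.ofReal_mul, Complex.ofReal_div]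
  field_simp

/-- Since βr = n, the power of the radius cancels the Jacobian and only the factor L/2 remains. -/
theorem lintegral_testFn [NeZero n] (J : ℕ) {P : ℕ → MvPolynomial (Fin n) ℂ}
    (hj : ∀ j, (P j).IsHomogeneous j) (d : ℕ → ℂ) {β r : ℝ} (hβ : 0 < β) (hr : 0 < r)
    (hβr : β * r = n) {L : ℝ} (hL : 0 < L) :
    ∫⁻ x, ‖testFn J P d β L x‖ₑ ^ r = ENNReal.ofReal (L / 2) *
      ∫⁻ z, ‖cutoffSum J (testProfile P d β) (fun j => (j + β) / 2) L z‖ₑ ^ r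
        ∂((surf n).prod volume) := by
  rw [lintegral_eq_lintegral_logPolar hL
    ((continuous_testFn J P d β L).enorm.measurable.pow_const r), ← lintegral_const_mul']
  swap
  · exact ENNReal.ofReal_ne_top
  refine lintegral_congr fun z => ?_
  rw [testFn_logPolar J hj d hβ, enorm_mul, ENNReal.mul_rpow_of_nonneg _ _ hr.le, ← mul_assoc]
  congr 1
  rw [← ofReal_norm, Complex.norm_real, Real.norm_of_nonneg (Real.exp_nonneg _),
    ENNReal.ofReal_rpow_of_nonneg (Real.exp_nonneg _) hr.le, ← ENNReal.ofReal_mul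
    (by unfold logPolarDensity; positivity), logPolarDensity, mul_assoc, ← Real.exp_mul,
    ← Real.exp_add, ← hβr]
  ring_nf
  simp

/-- Here β + β' = n cancels the Jacobian, and homogeneity makes m a function of the angle alone. -/
theorem integral_mul_testFn [NeZero n] (m : HomSymbol n) (J J' : ℕ)
    {P P' : ℕ → MvPolynomial (Fin n) ℂ}
    (hj : ∀ j, (P j).IsHomogeneous j) (hj' : ∀ j, (P' j).IsHomogeneous j) (d d' : ℕ → ℂ)
    {β β' : ℝ} (hβ : 0 < β) (hβ' : 0 < β') (hβr : β + β' = n) {L : ℝ} (hL : 0 < L) :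
    ∫ x, m.toFun x * testFn J P d β L x * (starRingEnd ℂ) (testFn J' P' d' β' L x) =
      ((L / 2 : ℝ) : ℂ) * ∫ z, m.toFun (z.1 : Rn n) *
        cutoffSum J (testProfile P d β) (fun j => (j + β) / 2) L z *
        (starRingEnd ℂ) (cutoffSum J' (testProfile P' d' β') (fun j => (j + β') / 2) L z)
        ∂((surf n).prod volume) := by
  rw [integral_eq_integral_logPolar hL, ← integral_const_mul]
  · refine integral_congr_ae (ae_of_all _ fun z => ?_)
    simp only
    have hm : m.toFun (logPolar n L z) = m.toFun (z.1 : Rn n) := by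
      refine m.homogeneous' _ (Real.exp_pos _) _ ?_
      intro h
      have := z.1.2
      simp [h] at this
    rw [hm, testFn_logPolar J hj d hβ, testFn_logPolar J' hj' d' hβ', map_mul, Complex.conj_ofReal,
      logPolarDensity, Complex.real_smul, ← hβr]
    have e : (Real.exp ((β + β') * (L * z.2 / 2)) : ℂ) * (Real.exp (-(β * (L * z.2 / 2))) : ℂ) *
        (Real.exp (-(β' * (L * z.2 / 2))) : ℂ) = 1 := by
      rw [← Complex.ofReal_mul, ← Complex.ofReal_mul, ← Real.exp_add, ← Real.exp_add]
      ring_nf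
      simp
    generalize cutoffSum J (testProfile P d β) (fun j => (j + β) / 2) L z = X
    generalize cutoffSum J' (testProfile P' d' β') (fun j => (j + β') / 2) L z = X'
    rw [Complex.ofReal_mul]
    linear_combination ((L / 2 : ℝ) : ℂ) * (m.toFun (z.1 : Rn n) * X * (starRingEnd ℂ) X') * e
  · exact (m.measurable'.mul (continuous_testFn J P d β L).measurable).mul
      (Complex.continuous_conj.comp (continuous_testFn J' P' d' β' L)).measurable

theorem surf_univ_ne_zero [NeZero n] : surf n Set.univ ≠ 0 := by
  have : Nonempty (Fin n) := ⟨0⟩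
  rw [Measure.measure_univ_ne_zero]
  exact Measure.toSphere_ne_zero _

/-- The weights normalizing the profiles of `testFn`. -/
def gaussWeight (β : ℝ) (j : ℕ) : ℂ :=
  ((Real.pi ^ ((j + β) / 2) / Real.Gamma ((j + β) / 2) : ℝ) : ℂ)

theorem testProfile_gaussWeight (P : ℕ → MvPolynomial (Fin n) ℂ) {β : ℝ} (hβ : 0 < β) (j : ℕ)
    (ω : Sph n) : testProfile P (gaussWeight β) β j ω = polyVal (P j) (ω : Rn n) := by
  have hG : Real.Gamma ((j + β) / 2) ≠ 0 := (Real.Gamma_pos_of_pos (by positivity)).ne'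
  have hpi : Real.pi ^ ((j + β) / 2) ≠ 0 := (Real.rpow_pos_of_pos Real.pi_pos _).ne'
  rw [testProfile, gaussWeight, ← Complex.ofReal_mul, div_mul_div_cancel₀ hG, div_self hpi]
  simp

/-- This is where γ_{n,j,α} arises, as the quotient of the Gamma weights after and before the
Fourier transform. -/
theorem testProfile_fourier (P : ℕ → MvPolynomial (Fin n) ℂ) {α β : ℝ} (hαβ : α + β = n)
    (j : ℕ) (ω : Sph n) :
    testProfile P (fun j => (-Complex.I) ^ j * gaussWeight β j) (n - β) j ω =
      Complex.I ^ (-(j : ℤ)) * (gammaCoeff n j α : ℂ) * polyVal (P j) (ω : Rn n) := by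
  obtain rfl : α = n - β := by linarith
  have e1 : Real.pi ^ ((n : ℝ) / 2 - (n - β)) =
      Real.pi ^ ((j + β) / 2) / Real.pi ^ ((j + (n - β)) / 2) := by
    rw [← Real.rpow_sub Real.pi_pos]
    congr 1
    ring
  have e2 : ((j : ℝ) + n - (n - β)) / 2 = (j + β) / 2 := by ring
  have e3 : Complex.I ^ (-(j : ℤ)) = (-Complex.I) ^ j := by
    rw [zpow_neg, zpow_natCast, ← inv_pow, Complex.inv_I]
  rw [testProfile, gaussWeight, gammaCoeff, e1, e2, e3]
  push_cast
  ring

/-- The multiplier bound for finite sums of spherical harmonics. -/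
theorem gammaCoeff_mul_enorm_le [NeZero n] (m : HomSymbol n) (J : ℕ)
    {P : ℕ → MvPolynomial (Fin n) ℂ} (hj : ∀ j, (P j).IsHomogeneous j)
    (hP : ∀ j, polyLaplacian n (P j) = 0) {p q : ℝ} (hpq : p.HolderConjugate q)
    (hA : m.normLp (ENNReal.ofReal p) ≠ ∞) :
    ENNReal.ofReal (gammaCoeff n 0 (n / q)) *
        ‖sphInner m fun ω => ∑ j ∈ Finset.range J,
          Complex.I ^ (-(j : ℤ)) * (gammaCoeff n j (n / p) : ℂ) * polyVal (P j) (ω : Rn n)‖ₑ ≤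
      m.normLp (ENNReal.ofReal p) * surf n Set.univ ^ (1 / p) *
        eLpNorm (fun ω : Sph n => ∑ j ∈ Finset.range J, polyVal (P j) (ω : Rn n))
          (ENNReal.ofReal q) (surf n) := by
  have hp := hpq.pos
  have hq := hpq.symm.pos
  have hn : (0 : ℝ) < n := Nat.cast_pos.mpr (Nat.pos_of_ne_zero (NeZero.ne n))
  have hsum : (n : ℝ) / p + n / q = n := by
    rw [div_eq_mul_inv, div_eq_mul_inv, ← mul_add, hpq.inv_add_inv_eq_one, mul_one]
  have hnp : 0 < (n : ℝ) / p := by positivity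
  have hnq : 0 < (n : ℝ) / q := by positivity
  have hsub1 : (n : ℝ) - n / p = n / q := by linarith
  have hsub2 : (n : ℝ) - n / q = n / p := by linarith
  have hpE : ENNReal.ofReal p ≠ 0 := by simpa using hp
  have hqE : ENNReal.ofReal q ≠ 0 := by simpa using hq
  set A := m.normLp (ENNReal.ofReal p) with hAdef
  -- The function f is radial: a single summand, the constant 1 in degree 0.
  let P0 : ℕ → MvPolynomial (Fin n) ℂ := fun j => if j = 0 then 1 else 0
  have hP0 : ∀ j, (P0 j).IsHomogeneous j := by
    intro j
    by_cases h : j = 0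
    · simp only [P0, h, if_true]; exact MvPolynomial.isHomogeneous_one _ _
    · simp only [P0, h, if_false]; exact MvPolynomial.isHomogeneous_zero _ _ _
  have hP0' : ∀ j, polyLaplacian n (P0 j) = 0 := by
    intro j
    by_cases h : j = 0
    · simp [P0, h, polyLaplacian_apply]
    · simp [P0, h]
  have hP0val : ∀ x : Rn n, polyVal (P0 0) x = 1 := by intro x; simp [P0, polyVal]
  have hpos : ∀ {β : ℝ}, 0 < β → ∀ j : ℕ, 0 < ((j : ℝ) + β) / 2 := fun h j => by positivity
  let Af := testProfile P0 (gaussWeight (n / p)) (n / p)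
  let Ag := testProfile P (gaussWeight (n / q)) (n / q)
  let Af' := testProfile P0 (fun j => (-Complex.I) ^ j * gaussWeight (n / p) j) (n / q)
  let Ag' := testProfile P (fun j => (-Complex.I) ^ j * gaussWeight (n / q) j) (n / p)
  let F : ℝ → ℝ≥0∞ := fun L => ∫⁻ z, ‖cutoffSum 1 Af (fun j => (j + n / p) / 2) L z‖ₑ ^ p
    ∂((surf n).prod volume)
  let G : ℝ → ℝ≥0∞ := fun L => ∫⁻ z, ‖cutoffSum J Ag (fun j => (j + n / q) / 2) L z‖ₑ ^ q
    ∂((surf n).prod volume)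
  let I : ℝ → ℂ := fun L => ∫ z, m.toFun (z.1 : Rn n) *
    cutoffSum 1 Af' (fun j => (j + n / q) / 2) L z *
    (starRingEnd ℂ) (cutoffSum J Ag' (fun j => (j + n / p) / 2) L z) ∂((surf n).prod volume)
  have hF := tendsto_lintegral_cutoffSum 1 (hpos hnp)
    (continuous_testProfile P0 (gaussWeight (n / p)) (n / p)) hp
  have hG := tendsto_lintegral_cutoffSum J (hpos hnq)
    (continuous_testProfile P (gaussWeight (n / q)) (n / q)) hq
  have hI := tendsto_integral_cutoffSum 1 J (hpos hnq)
    (continuous_testProfile P0 (fun j => (-Complex.I) ^ j * gaussWeight (n / p) j) (n / q))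
    (hpos hnp) (continuous_testProfile P (fun j => (-Complex.I) ^ j * gaussWeight (n / q) j) (n /
        p))
    m
  -- Duality applied to the pair f, g. Since 1/p + 1/q = 1, both sides carry exactly one factor L/2,
  -- which is cancelled.
  have hbound : ∀ L, 0 < L → ‖I L‖ₑ ≤ A * F L ^ (1 / p) * G L ^ (1 / q) := by
    intro L hL
    let f := testFn 1 P0 (gaussWeight (n / p)) (n / p) L
    let g := testFn J P (gaussWeight (n / q)) (n / q) L
    have ef : 𝓕 f = testFn 1 P0 (fun j => (-Complex.I) ^ j * gaussWeight (n / p) j) (n / q) L := by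
      rw [← hsub1]; exact fourier_testFn 1 hP0 hP0' _ _ hL.le
    have eg : 𝓕 g = testFn J P (fun j => (-Complex.I) ^ j * gaussWeight (n / q) j) (n / p) L := by
      rw [← hsub2]; exact fourier_testFn J hj hP _ _ hL.le
    have hHC : (ENNReal.ofReal p).HolderConjugate (ENNReal.ofReal q) := hpq.ennrealOfReal
    have h1 := m.enorm_integral_fourier_le (p := ENNReal.ofReal p) (q := ENNReal.ofReal q) hpE
      (f := f) (g := g)
      (memLp_one_iff_integrable.mp (memLp_testFn _ _ _ _ hL.le one_ne_zero ENNReal.one_ne_top))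
      (memLp_testFn _ _ _ _ hL.le two_ne_zero ENNReal.ofNat_ne_top)
      (memLp_testFn _ _ _ _ hL.le hpE ENNReal.ofReal_ne_top)
      (by rw [ef]; exact memLp_testFn _ _ _ _ hL.le two_ne_zero ENNReal.ofNat_ne_top)
      (memLp_one_iff_integrable.mp (memLp_testFn _ _ _ _ hL.le one_ne_zero ENNReal.one_ne_top))
      (memLp_testFn _ _ _ _ hL.le two_ne_zero ENNReal.ofNat_ne_top)
      (by rw [eg]; exact memLp_testFn _ _ _ _ hL.le two_ne_zero ENNReal.ofNat_ne_top)
    have e1 : ∫ ξ, m.toFun ξ * (𝓕 f) ξ * (starRingEnd ℂ) ((𝓕 g) ξ) = ((L / 2 : ℝ) : ℂ) * I L := by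
      rw [ef, eg]
      exact integral_mul_testFn m 1 J hP0 hj _ _ hnq hnp (by linarith) hL
    have e2 : eLpNorm f (ENNReal.ofReal p) volume =
        ENNReal.ofReal (L / 2) ^ (1 / p) * F L ^ (1 / p) := by
      rw [eLpNorm_eq_lintegral_rpow_enorm_toReal hpE ENNReal.ofReal_ne_top,
        ENNReal.toReal_ofReal hp.le,
        lintegral_testFn 1 hP0 _ hnp hp (div_mul_cancel₀ _ hp.ne') hL,
        ENNReal.mul_rpow_of_nonneg _ _ (by positivity)]
    have e3 : eLpNorm g (ENNReal.ofReal q) volume =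
        ENNReal.ofReal (L / 2) ^ (1 / q) * G L ^ (1 / q) := by
      rw [eLpNorm_eq_lintegral_rpow_enorm_toReal hqE ENNReal.ofReal_ne_top,
        ENNReal.toReal_ofReal hq.le,
        lintegral_testFn J hj _ hnq hq (div_mul_cancel₀ _ hq.ne') hL,
        ENNReal.mul_rpow_of_nonneg _ _ (by positivity)]
    have hl0 : ENNReal.ofReal (L / 2) ≠ 0 := by simpa using hL
    have e4 : ENNReal.ofReal (L / 2) ^ (1 / p) * ENNReal.ofReal (L / 2) ^ (1 / q) =
        ENNReal.ofReal (L / 2) := by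
      rw [← ENNReal.rpow_add _ _ hl0 ENNReal.ofReal_ne_top, one_div, one_div,
        hpq.inv_add_inv_eq_one, ENNReal.rpow_one]
    rw [e1, e2, e3, enorm_mul, ← ofReal_norm ((L / 2 : ℝ) : ℂ), Complex.norm_real,
      Real.norm_of_nonneg (by positivity)] at h1
    have h2 : ENNReal.ofReal (L / 2) * ‖I L‖ₑ ≤
        ENNReal.ofReal (L / 2) * (A * F L ^ (1 / p) * G L ^ (1 / q)) := by
      refine h1.trans (le_of_eq ?_)
      rw [← hAdef]
      conv_rhs => rw [← e4]
      ring
    exact (ENNReal.mul_le_mul_iff_right hl0 ENNReal.ofReal_ne_top).mp h2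
  have hF1 : 2 * ∫⁻ ω, ‖∑ j ∈ Finset.range 1, Af j ω‖ₑ ^ p ∂(surf n) = 2 * surf n Set.univ := by
    simp only [Finset.sum_range_one, Af, testProfile_gaussWeight P0 hnp, hP0val]
    simp
  have hG1 : (∫⁻ ω, ‖∑ j ∈ Finset.range J, Ag j ω‖ₑ ^ q ∂(surf n)) ^ (1 / q) =
      eLpNorm (fun ω : Sph n => ∑ j ∈ Finset.range J, polyVal (P j) (ω : Rn n))
          (ENNReal.ofReal q) (surf n) := by
    rw [eLpNorm_eq_lintegral_rpow_enorm_toReal hqE ENNReal.ofReal_ne_top,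
        ENNReal.toReal_ofReal hq.le]
    simp only [Ag, testProfile_gaussWeight P hnq]
  have hGfin : ∫⁻ ω, ‖∑ j ∈ Finset.range J, Ag j ω‖ₑ ^ q ∂(surf n) ≠ ∞ := by
    have hc : Continuous fun ω : Sph n => ∑ j ∈ Finset.range J, Ag j ω :=
      continuous_finsetSum _ fun j _ => continuous_testProfile P (gaussWeight (n / q)) (n / q) j
    have hmem : MemLp (fun ω : Sph n => ∑ j ∈ Finset.range J, Ag j ω) (ENNReal.ofReal q) (surf n)
        := by
      obtain ⟨C, hC⟩ := (isCompact_univ (X := Sph n)).exists_bound_of_continuousOn hc.continuousOn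
      exact MemLp.of_bound hc.aestronglyMeasurable C (ae_of_all _ fun ω => hC ω (Set.mem_univ _))
    have := lintegral_rpow_enorm_lt_top_of_eLpNorm_lt_top hqE ENNReal.ofReal_ne_top hmem.2
    rw [ENNReal.toReal_ofReal hq.le] at this
    exact this.ne
  -- Finiteness of A and of the limits is what makes multiplication in `ℝ≥0∞` continuous here.
  have hlim : Tendsto (fun L => A * F L ^ (1 / p) * G L ^ (1 / q)) atTop
      (𝓝 (A * (2 * surf n Set.univ) ^ (1 / p) *
        (2 * ∫⁻ ω, ‖∑ j ∈ Finset.range J, Ag j ω‖ₑ ^ q ∂(surf n)) ^ (1 / q))) := by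
    have hF2 := (ENNReal.continuous_rpow_const (y := 1 / p)).tendsto _ |>.comp hF
    have hG2 := (ENNReal.continuous_rpow_const (y := 1 / q)).tendsto _ |>.comp hG
    have h1 : (2 * surf n Set.univ) ^ (1 / p) ≠ ∞ :=
      ENNReal.rpow_ne_top_of_nonneg (by positivity)
        (ENNReal.mul_ne_top ENNReal.ofNat_ne_top (measure_ne_top _ _))
    rw [hF1] at hF2
    refine ENNReal.Tendsto.mul (ENNReal.Tendsto.const_mul hF2 (Or.inr hA)) (Or.inr ?_) hG2 (Or.inr
        ?_)
    · exact ENNReal.rpow_ne_top_of_nonneg (by positivity)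
        (ENNReal.mul_ne_top ENNReal.ofNat_ne_top hGfin)
    · exact ENNReal.mul_ne_top hA h1
  have hle := le_of_tendsto_of_tendsto ((continuous_enorm.tendsto _).comp hI) hlim
    ((eventually_gt_atTop 0).mono hbound)
  have hIval : ∫ ω, m.toFun (ω : Rn n) * (∑ j ∈ Finset.range 1, Af' j ω) *
        (starRingEnd ℂ) (∑ j ∈ Finset.range J, Ag' j ω) ∂(surf n) =
      (gammaCoeff n 0 (n / q) : ℂ) * sphInner m fun ω => ∑ j ∈ Finset.range J,
          Complex.I ^ (-(j : ℤ)) * (gammaCoeff n j (n / p) : ℂ) * polyVal (P j) (ω : Rn n) := by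
    have e1 : ∀ j ω, Af' j ω =
        Complex.I ^ (-(j : ℤ)) * (gammaCoeff n j (n / q) : ℂ) * polyVal (P0 j) (ω : Rn n) := by
      intro j ω
      rw [← testProfile_fourier P0 (show (n : ℝ) / q + n / p = n by linarith), hsub1]
    have e2 : ∀ j ω, Ag' j ω =
        Complex.I ^ (-(j : ℤ)) * (gammaCoeff n j (n / p) : ℂ) * polyVal (P j) (ω : Rn n) := by
      intro j ω
      rw [← testProfile_fourier P hsum, hsub2]
    rw [sphInner, ← integral_const_mul]
    refine integral_congr_ae (ae_of_all _ fun ω => ?_)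
    simp only [Finset.sum_range_one, e1, e2, hP0val]
    simp only [Nat.cast_zero, neg_zero, zpow_zero]
    ring
  have hγ : ‖(gammaCoeff n 0 (n / q) : ℂ)‖ₑ = ENNReal.ofReal (gammaCoeff n 0 (n / q)) := by
    rw [← ofReal_norm, Complex.norm_real, Real.norm_of_nonneg]
    have h1 := Real.Gamma_pos_of_pos (s := ((0 : ℕ) + (n : ℝ) / q) / 2) (by simpa using hnq)
    have h2 := Real.Gamma_pos_of_pos (s := ((0 : ℕ) + (n : ℝ) - n / q) / 2)
      (by rw [Nat.cast_zero, zero_add, hsub2]; positivity)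
    unfold gammaCoeff
    positivity
  rw [hIval, enorm_mul, enorm_mul, hγ, ENNReal.mul_rpow_of_nonneg _ _ (by positivity),
    ENNReal.mul_rpow_of_nonneg _ _ (by positivity), hG1] at hle
  have h2 : (2 : ℝ≥0∞) ^ (1 / p) * 2 ^ (1 / q) = 2 := by
    rw [← ENNReal.rpow_add _ _ two_ne_zero ENNReal.ofNat_ne_top, one_div, one_div,
      hpq.inv_add_inv_eq_one, ENNReal.rpow_one]
  have h2e : ‖(2 : ℂ)‖ₑ = 2 := by
    rw [← ofReal_norm]; simp
  rw [h2e] at hle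
  refine (ENNReal.mul_le_mul_iff_right two_ne_zero ENNReal.ofNat_ne_top).mp (hle.trans (le_of_eq
      ?_))
  generalize eLpNorm (fun ω : Sph n => ∑ j ∈ Finset.range J, polyVal (P j) (ω : Rn n))
          (ENNReal.ofReal q) (surf n) = U
  trans (2 ^ (1 / p) * 2 ^ (1 / q)) * (A * surf n Set.univ ^ (1 / p) * U)
  · ring
  · rw [h2]

end TestFunctions

/-! ### From finite sums to series. -/

section Limits

variable {n : ℕ}

theorem integrable_mul_conj_of_integrable (m : HomSymbol n) {v : Sph n → ℂ}
    (hv : Integrable v (surf n)) :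
    Integrable (fun ω : Sph n => m.toFun (ω : Rn n) * (starRingEnd ℂ) (v ω)) (surf n) := by
  obtain ⟨M, _, hM⟩ := m.exists_norm_le
  have h1 : Integrable (fun ω => (starRingEnd ℂ) (v ω)) (surf n) :=
    (memLp_one_iff_integrable.mp ((memLp_one_iff_integrable.mpr hv).star))
  exact h1.bdd_mul (m.measurable'.comp measurable_subtype_coe).aestronglyMeasurable
    (ae_of_all _ fun ω => hM _)

/-- Boundedness of m, then Hölder's inequality on the finite measure space of the sphere. -/
theorem edist_sphInner_le (m : HomSymbol n) {M : ℝ} (hM : ∀ ξ, ‖m.toFun ξ‖ ≤ M) {v w : Sph n → ℂ}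
    (hv : MemLp v 2 (surf n)) (hw : MemLp w 2 (surf n)) :
    edist (sphInner m w) (sphInner m v) ≤ ENNReal.ofReal M *
      (eLpNorm (fun ω => w ω - v ω) 2 (surf n) * surf n Set.univ ^ (1 / 2 : ℝ)) := by
  have hv1 : Integrable v (surf n) := hv.integrable one_le_two
  have hw1 : Integrable w (surf n) := hw.integrable one_le_two
  rw [edist_eq_enorm_sub, sphInner, sphInner, ← integral_sub (integrable_mul_conj_of_integrable m
      hw1)
    (integrable_mul_conj_of_integrable m hv1)]
  refine (enorm_integral_le_lintegral_enorm _).trans ?_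
  have h1 : ∀ ω : Sph n, ‖m.toFun (ω : Rn n) * (starRingEnd ℂ) (w ω) -
      m.toFun (ω : Rn n) * (starRingEnd ℂ) (v ω)‖ₑ ≤ ENNReal.ofReal M * ‖w ω - v ω‖ₑ := by
    intro ω
    rw [← mul_sub, ← map_sub, enorm_mul]
    gcongr
    · rw [← ofReal_norm]; exact ENNReal.ofReal_le_ofReal (hM _)
    · rw [← ofReal_norm, RCLike.norm_conj, ofReal_norm]
  refine (lintegral_mono h1).trans ?_
  rw [lintegral_const_mul' _ _ ENNReal.ofReal_ne_top]
  gcongr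
  rw [← eLpNorm_one_eq_lintegral_enorm]
  have h2 := eLpNorm_le_eLpNorm_mul_rpow_measure_univ (p := 1) (q := 2) one_le_two
    (hw.sub hv).aestronglyMeasurable
  refine h2.trans (le_of_eq ?_)
  congr 2
  norm_num

theorem tendsto_sphInner (m : HomSymbol n) {V : ℕ → Sph n → ℂ} {v : Sph n → ℂ}
    (hV : ∀ j, Continuous (V j)) (h : SeriesConverges 2 V v) :
    Tendsto (fun J => sphInner m fun ω => ∑ j ∈ Finset.range J, V j ω) atTop
      (𝓝 (sphInner m v)) := by
  obtain ⟨M, _, hM⟩ := m.exists_norm_le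
  have hmem : ∀ J, MemLp (fun ω => ∑ j ∈ Finset.range J, V j ω) 2 (surf n) := by
    intro J
    have hc : Continuous fun ω => ∑ j ∈ Finset.range J, V j ω :=
      continuous_finsetSum _ fun j _ => hV j
    obtain ⟨C, hC⟩ := (isCompact_univ (X := Sph n)).exists_bound_of_continuousOn hc.continuousOn
    exact MemLp.of_bound hc.aestronglyMeasurable C (ae_of_all _ fun ω => hC ω (Set.mem_univ _))
  rw [tendsto_iff_edist_tendsto_0]
  have h2 : Tendsto (fun J => ENNReal.ofReal M *
      (eLpNorm (fun ω => (∑ j ∈ Finset.range J, V j ω) - v ω) 2 (surf n) *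
        surf n Set.univ ^ (1 / 2 : ℝ))) atTop (𝓝 0) := by
    have := ENNReal.Tendsto.const_mul (a := ENNReal.ofReal M) (ENNReal.Tendsto.mul_const
      (b := surf n Set.univ ^ (1 / 2 : ℝ)) h.2 (Or.inr
      (ENNReal.rpow_ne_top_of_nonneg (by positivity) (measure_ne_top _ _))))
      (Or.inr ENNReal.ofReal_ne_top)
    simpa using this
  exact tendsto_of_tendsto_of_tendsto_of_le_of_le tendsto_const_nhds h2 (fun _ => zero_le)
    fun J => edist_sphInner_le m hM h.1 (hmem J)

/-- The left side converges by L² continuity of the pairing with m. On the right the triangle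
inequality suffices, and it holds for q = ∞ as well. -/
theorem mul_enorm_sphInner_le_of_series (m : HomSymbol n) {Y V : ℕ → Sph n → ℂ} {u v : Sph n → ℂ}
    (hY : ∀ j, Continuous (Y j)) (hV : ∀ j, Continuous (V j)) {q : ℝ≥0∞} (hq : 1 ≤ q)
    (hu : SeriesConverges q Y u) (hv : SeriesConverges 2 V v) {κ B : ℝ≥0∞} (hκ : κ ≠ ∞)
    (hB : B ≠ ∞)
    (h : ∀ J, κ * ‖sphInner m fun ω => ∑ j ∈ Finset.range J, V j ω‖ₑ ≤
      B * eLpNorm (fun ω => ∑ j ∈ Finset.range J, Y j ω) q (surf n)) :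
    κ * ‖sphInner m v‖ₑ ≤ B * eLpNorm u q (surf n) := by
  have h1 : Tendsto (fun J => κ * ‖sphInner m fun ω => ∑ j ∈ Finset.range J, V j ω‖ₑ) atTop
      (𝓝 (κ * ‖sphInner m v‖ₑ)) :=
    ENNReal.Tendsto.const_mul ((continuous_enorm.tendsto _).comp (tendsto_sphInner m hV hv))
      (Or.inr hκ)
  have h2 : Tendsto (fun J => B * (eLpNorm (fun ω => (∑ j ∈ Finset.range J,
      Y j ω) - u ω) q (surf n) +
      eLpNorm u q (surf n))) atTop (𝓝 (B * eLpNorm u q (surf n))) := by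
    have := ENNReal.Tendsto.const_mul (a := B) (hu.2.add_const (eLpNorm u q (surf n))) (Or.inr hB)
    simpa using this
  refine le_of_tendsto_of_tendsto' h1 h2 fun J => (h J).trans ?_
  gcongr
  have hc : Continuous fun ω => ∑ j ∈ Finset.range J, Y j ω :=
    continuous_finsetSum _ fun j _ => hY j
  have := eLpNorm_add_le (μ := surf n) (p := q)
    (hc.aestronglyMeasurable.sub hu.1.aestronglyMeasurable) hu.1.aestronglyMeasurable hq
  rw [sub_add_cancel] at this
  exact this

end Limits

/-! ### Continuity and the pole of γ_{n,j,α}. -/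

section GammaConstants

/-- It also holds at x = 0, because `Real.Gamma 0 = 0` and the inverse of 0 is 0, in accordance with
1/Γ(0) = 0. -/
theorem Real.inv_Gamma_eq (x : ℝ) : (Real.Gamma x)⁻¹ = x * (Real.Gamma (x + 1))⁻¹ := by
  rcases eq_or_ne x 0 with rfl | hx
  · simp
  · rw [Real.Gamma_add_one hx, mul_inv, ← mul_assoc, mul_inv_cancel₀ hx, one_mul]

theorem Real.continuousAt_Gamma_of_pos {x : ℝ} (hx : 0 < x) : ContinuousAt Real.Gamma x :=
  (Real.differentiableAt_Gamma fun k => by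
    have : (0 : ℝ) ≤ k := Nat.cast_nonneg k
    linarith).continuousAt

/-- The pole of Γ at 0 becomes a zero of the reciprocal. The point 0 is needed for j = 0 and α = n,
which is the case p = 1. -/
theorem Real.continuousAt_inv_Gamma {x : ℝ} (hx : 0 ≤ x) :
    ContinuousAt (fun x => (Real.Gamma x)⁻¹) x := by
  have h : (fun x => (Real.Gamma x)⁻¹) = fun x => x * (Real.Gamma (x + 1))⁻¹ :=
    funext Real.inv_Gamma_eq
  rw [h]
  have h1 : ContinuousAt (fun x : ℝ => Real.Gamma (x + 1)) x :=
    ContinuousAt.comp' (f := fun x : ℝ => x + 1) (Real.continuousAt_Gamma_of_pos (by linarith))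
      (by fun_prop)
  exact continuousAt_id.mul (h1.inv₀ (Real.Gamma_pos_of_pos (by linarith)).ne')

theorem continuousAt_gammaCoeff {n j : ℕ} {α : ℝ} (h1 : 0 < α) (h2 : α ≤ n) :
    ContinuousAt (gammaCoeff n j) α := by
  unfold gammaCoeff
  simp only [div_eq_mul_inv (Real.Gamma _)]
  have e1 : ContinuousAt (fun α : ℝ => Real.Gamma ((j + α) / 2)) α :=
    ContinuousAt.comp' (f := fun α : ℝ => (j + α) / 2)
      (Real.continuousAt_Gamma_of_pos (by positivity)) (by fun_prop)
  have e2 : ContinuousAt (fun α : ℝ => (Real.Gamma ((j + n - α) / 2))⁻¹) α :=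
    ContinuousAt.comp' (g := fun x => (Real.Gamma x)⁻¹) (f := fun α : ℝ => (j + n - α) / 2)
      (Real.continuousAt_inv_Gamma (by have : (0 : ℝ) ≤ j := Nat.cast_nonneg j; linarith))
      (by fun_prop)
  have e3 : ContinuousAt (fun α : ℝ => Real.pi ^ ((n : ℝ) / 2 - α)) α :=
    (Real.continuousAt_const_rpow Real.pi_ne_zero).comp' (f := fun α : ℝ => (n : ℝ) / 2 - α)
      (by fun_prop)
  exact e3.mul (e1.mul e2)

/-- The regular part of `gammaCoeff n 0 (n * s)` at `s = 0`. -/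
def gammaReg (n : ℕ) (s : ℝ) : ℝ :=
  Real.pi ^ ((n : ℝ) / 2 - n * s) * (2 / n) * (Real.Gamma (n * s / 2 + 1) / Real.Gamma ((n - n *
      s) / 2))

variable {n : ℕ}

/-- The functional equation Γ(z) = Γ(z+1)/z at z = ns/2 isolates the pole at s = 0. -/
theorem gammaCoeff_zero_eq [NeZero n] {s : ℝ} (hs : s ≠ 0) :
    gammaCoeff n 0 (n * s) = gammaReg n s / s := by
  have hn : (n : ℝ) ≠ 0 := Nat.cast_ne_zero.mpr (NeZero.ne n)
  have h : (n : ℝ) * s / 2 ≠ 0 := by positivity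
  rw [gammaCoeff, gammaReg, Real.Gamma_add_one h, Nat.cast_zero, zero_add, zero_add]
  field_simp

theorem gammaReg_pos [NeZero n] {s : ℝ} (hs : 0 ≤ s) (hs' : s < 1) : 0 < gammaReg n s := by
  have hn : (0 : ℝ) < n := Nat.cast_pos.mpr (Nat.pos_of_ne_zero (NeZero.ne n))
  have h1 := Real.Gamma_pos_of_pos (s := n * s / 2 + 1) (by positivity)
  have h2 := Real.Gamma_pos_of_pos (s := (n - n * s) / 2) (by nlinarith)
  unfold gammaReg
  positivity

theorem continuousAt_gammaReg [NeZero n] {s : ℝ} (hs : 0 ≤ s) (hs' : s < 1) :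
    ContinuousAt (gammaReg n) s := by
  have hn : (0 : ℝ) < n := Nat.cast_pos.mpr (Nat.pos_of_ne_zero (NeZero.ne n))
  have h2 : 0 < ((n : ℝ) - n * s) / 2 := by nlinarith
  unfold gammaReg
  have e1 : ContinuousAt (fun s : ℝ => Real.Gamma (n * s / 2 + 1)) s :=
    ContinuousAt.comp' (f := fun s : ℝ => n * s / 2 + 1)
      (Real.continuousAt_Gamma_of_pos (by positivity)) (by fun_prop)
  have e2 : ContinuousAt (fun s : ℝ => Real.Gamma (((n : ℝ) - n * s) / 2)) s :=
    ContinuousAt.comp' (f := fun s : ℝ => ((n : ℝ) - n * s) / 2)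
      (Real.continuousAt_Gamma_of_pos h2) (by fun_prop)
  have e3 : ContinuousAt (fun s : ℝ => Real.pi ^ ((n : ℝ) / 2 - n * s)) s :=
    (Real.continuousAt_const_rpow Real.pi_ne_zero).comp' (f := fun s : ℝ => (n : ℝ) / 2 - n * s)
      (by fun_prop)
  exact (e3.mul continuousAt_const).mul (e1.div e2 (Real.Gamma_pos_of_pos h2).ne')

/-- The mass of the sphere is n times the residue of the pole; this ratio is the origin of the 1/n
in the weak type bound. -/
theorem surf_univ_eq [NeZero n] : surf n Set.univ = ENNReal.ofReal (n * gammaReg n 0) := by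
  have hn : (n : ℝ) ≠ 0 := Nat.cast_ne_zero.mpr (NeZero.ne n)
  have : Nonempty (Fin n) := ⟨0⟩
  rw [Measure.toSphere_apply_univ, EuclideanSpace.volume_ball, finrank_euclideanSpace_fin,
    ← ENNReal.ofReal_natCast n, ENNReal.ofReal_one, one_pow, one_mul,
    ← ENNReal.ofReal_mul (by positivity), Fintype.card_fin, gammaReg,
    Real.Gamma_add_one (by positivity)]
  have e : √Real.pi ^ n = Real.pi ^ ((n : ℝ) / 2) := by
    rw [Real.sqrt_eq_rpow, ← Real.rpow_natCast, ← Real.rpow_mul Real.pi_pos.le]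
    ring_nf
  rw [e]
  congr 1
  simp
  field_simp
  simp

/-- With s = 1/q the right side is q times a positive continuous function of s on the compact
interval [0, 1/2]. The constant is its minimum, and q ≥ q - 1. -/
theorem exists_le_gammaCoeff_div [NeZero n] : ∃ c : ℝ, 0 < c ∧ ∀ p q : ℝ, p.HolderConjugate q →
    2 ≤ q → ENNReal.ofReal (c * (q - 1)) ≤
      ENNReal.ofReal (gammaCoeff n 0 (n / q)) / surf n Set.univ ^ (1 / p) := by
  have hn : (0 : ℝ) < n := Nat.cast_pos.mpr (Nat.pos_of_ne_zero (NeZero.ne n))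
  set σ : ℝ := n * gammaReg n 0 with hσ
  have hσ0 : 0 < σ := mul_pos hn (gammaReg_pos le_rfl one_pos)
  have hcont : ContinuousOn (fun s => gammaReg n s / σ ^ (1 - s)) (Set.Icc 0 (1 / 2)) := by
    intro s hs
    refine ContinuousAt.continuousWithinAt ?_
    have e3 : ContinuousAt (fun s : ℝ => σ ^ (1 - s)) s :=
      (Real.continuousAt_const_rpow hσ0.ne').comp' (f := fun s : ℝ => 1 - s) (by fun_prop)
    exact (continuousAt_gammaReg hs.1 (by linarith [hs.2])).div e3
      (Real.rpow_pos_of_pos hσ0 _).ne'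
  obtain ⟨s0, hs0, hmin⟩ := isCompact_Icc.exists_isMinOn ⟨0, by norm_num⟩ hcont
  set c := gammaReg n s0 / σ ^ (1 - s0) with hc
  have hc0 : 0 < c := div_pos (gammaReg_pos hs0.1 (by linarith [hs0.2])) (Real.rpow_pos_of_pos hσ0
      _)
  refine ⟨c, hc0, fun p q hpq hq => ?_⟩
  have hq0 : 0 < q := by linarith
  have hmem : q⁻¹ ∈ Set.Icc (0 : ℝ) (1 / 2) := by
    refine ⟨by positivity, ?_⟩
    rw [one_div]
    exact inv_anti₀ two_pos hq
  have h1 : c ≤ gammaReg n q⁻¹ / σ ^ (1 - q⁻¹) := hmin hmem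
  have hp1 : 1 - q⁻¹ = 1 / p := by
    have := hpq.inv_add_inv_eq_one
    rw [one_div]; linarith
  rw [surf_univ_eq, ENNReal.ofReal_rpow_of_pos hσ0,
    ← ENNReal.ofReal_div_of_pos (Real.rpow_pos_of_pos hσ0 _)]
  apply ENNReal.ofReal_le_ofReal
  rw [div_eq_mul_inv (n : ℝ) q, gammaCoeff_zero_eq (inv_ne_zero hq0.ne'), div_inv_eq_mul,
    mul_div_right_comm, ← hp1]
  calc c * (q - 1) ≤ c * q := by nlinarith
    _ ≤ _ := by gcongr

end GammaConstants

/-! ### Integrals over truncation levels. -/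

section Marcinkiewicz

theorem lintegral_Ioo_rpow {w r : ℝ} (hw : 0 ≤ w) (hr : -1 < r) :
    ∫⁻ t in Set.Ioo 0 w, ENNReal.ofReal (t ^ r) = ENNReal.ofReal (w ^ (r + 1) / (r + 1)) := by
  have hi : IntegrableOn (fun t : ℝ => t ^ r) (Set.Ioo 0 w) :=
    ((intervalIntegrable_iff_integrableOn_Ioc_of_le hw).mp
      (intervalIntegral.intervalIntegrable_rpow' hr)).mono_set Set.Ioo_subset_Ioc_self
  rw [← ofReal_integral_eq_lintegral_ofReal hi, ← integral_Ioc_eq_integral_Ioo,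
    ← intervalIntegral.integral_of_le hw, integral_rpow (Or.inl hr), Real.zero_rpow (by linarith),
    sub_zero]
  filter_upwards [ae_restrict_mem measurableSet_Ioo] with t ht
  exact Real.rpow_nonneg ht.1.le _

theorem lintegral_Ici_rpow {w r : ℝ} (hw : 0 < w) (hr : r < -1) :
    ∫⁻ t in Set.Ici w, ENNReal.ofReal (t ^ r) = ENNReal.ofReal (-w ^ (r + 1) / (r + 1)) := by
  have hi := integrableOn_Ioi_rpow_of_lt hr hw
  rw [setLIntegral_congr Ioi_ae_eq_Ici.symm, ← ofReal_integral_eq_lintegral_ofReal hi,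
    integral_Ioi_rpow_of_lt hr hw]
  filter_upwards [ae_restrict_mem measurableSet_Ioi] with t ht
  exact Real.rpow_nonneg (hw.trans ht).le _

variable {α : Type*} [MeasurableSpace α] {μ : Measure α} [SFinite μ]

/-- Tonelli: the inner integral runs over 0 < t < w and converges at 0 because p > 1. -/
theorem lintegral_rpow_mul_lintegral_large {w : α → ℝ} (hw : Measurable w) (hw0 : ∀ x, 0 ≤ w x)
    {p : ℝ} (hp : 1 < p) :
    ∫⁻ t in Set.Ioi (0 : ℝ), ENNReal.ofReal (t ^ (p - 2)) *
        ∫⁻ x, Set.indicator {x | t < w x} (fun x => ENNReal.ofReal (w x)) x ∂μ =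
      ENNReal.ofReal (1 / (p - 1)) * ∫⁻ x, ENNReal.ofReal (w x ^ p) ∂μ := by
  have hmS : MeasurableSet {z : ℝ × α | z.1 < w z.2} :=
    measurableSet_lt measurable_fst (hw.comp measurable_snd)
  have hmeas : Measurable fun z : ℝ × α => ENNReal.ofReal (z.1 ^ (p - 2)) *
      Set.indicator {z : ℝ × α | z.1 < w z.2} (fun z => ENNReal.ofReal (w z.2)) z :=
    (ENNReal.measurable_ofReal.comp (measurable_fst.pow_const _)).mul
      ((ENNReal.measurable_ofReal.comp (hw.comp measurable_snd)).indicator hmS)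
  have h1 : ∀ t : ℝ, ENNReal.ofReal (t ^ (p - 2)) *
        ∫⁻ x, Set.indicator {x | t < w x} (fun x => ENNReal.ofReal (w x)) x ∂μ =
      ∫⁻ x, ENNReal.ofReal (t ^ (p - 2)) *
        Set.indicator {z : ℝ × α | z.1 < w z.2} (fun z => ENNReal.ofReal (w z.2)) (t, x) ∂μ := by
    intro t
    rw [lintegral_const_mul' _ _ ENNReal.ofReal_ne_top]
    rfl
  simp_rw [h1]
  rw [lintegral_lintegral_swap hmeas.aemeasurable,
    ← lintegral_const_mul' _ _ ENNReal.ofReal_ne_top]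
  refine lintegral_congr fun x => ?_
  have h2 : ∀ t : ℝ, ENNReal.ofReal (t ^ (p - 2)) *
        Set.indicator {z : ℝ × α | z.1 < w z.2} (fun z => ENNReal.ofReal (w z.2)) (t, x) =
      ENNReal.ofReal (w x) *
        Set.indicator (Set.Iio (w x)) (fun t => ENNReal.ofReal (t ^ (p - 2))) t := by
    intro t
    by_cases ht : t < w x
    · rw [Set.indicator_of_mem (show (t, x) ∈ {z : ℝ × α | z.1 < w z.2} from ht),
        Set.indicator_of_mem (show t ∈ Set.Iio (w x) from ht), mul_comm]
    · rw [Set.indicator_of_notMem (show (t, x) ∉ {z : ℝ × α | z.1 < w z.2} from ht),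
        Set.indicator_of_notMem (show t ∉ Set.Iio (w x) from ht), mul_zero, mul_zero]
  simp_rw [h2]
  rw [lintegral_const_mul' _ _ ENNReal.ofReal_ne_top, lintegral_indicator measurableSet_Iio,
    Measure.restrict_restrict measurableSet_Iio, Set.inter_comm, Set.Ioi_inter_Iio,
    lintegral_Ioo_rpow (hw0 x) (by linarith), ← ENNReal.ofReal_mul (hw0 x),
    ← ENNReal.ofReal_mul (by rw [one_div]; exact inv_nonneg.mpr (by linarith))]
  congr 1
  have e : p - 2 + 1 = p - 1 := by ring
  rw [e]
  rcases (hw0 x).eq_or_lt with h | h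
  · rw [← h, Real.zero_rpow (by linarith : p ≠ 0)]; simp
  · rw [Real.rpow_sub_one h.ne']
    have : p - 1 ≠ 0 := by linarith
    field_simp

/-- Tonelli again: now t runs over [w, ∞), and p < 2 gives convergence at infinity. -/
theorem lintegral_rpow_mul_lintegral_small {w : α → ℝ} (hw : Measurable w) (hw0 : ∀ x, 0 ≤ w x)
    {p : ℝ} (hp0 : 0 < p) (hp : p < 2) :
    ∫⁻ t in Set.Ioi (0 : ℝ), ENNReal.ofReal (t ^ (p - 3)) *
        ∫⁻ x, Set.indicator {x | w x ≤ t} (fun x => ENNReal.ofReal (w x ^ 2)) x ∂μ =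
      ENNReal.ofReal (1 / (2 - p)) * ∫⁻ x, ENNReal.ofReal (w x ^ p) ∂μ := by
  have hmS : MeasurableSet {z : ℝ × α | w z.2 ≤ z.1} :=
    measurableSet_le (hw.comp measurable_snd) measurable_fst
  have hmeas : Measurable fun z : ℝ × α => ENNReal.ofReal (z.1 ^ (p - 3)) *
      Set.indicator {z : ℝ × α | w z.2 ≤ z.1} (fun z => ENNReal.ofReal (w z.2 ^ 2)) z :=
    (ENNReal.measurable_ofReal.comp (measurable_fst.pow_const _)).mul
      ((ENNReal.measurable_ofReal.comp ((hw.comp measurable_snd).pow_const 2)).indicator hmS)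
  have h1 : ∀ t : ℝ, ENNReal.ofReal (t ^ (p - 3)) *
        ∫⁻ x, Set.indicator {x | w x ≤ t} (fun x => ENNReal.ofReal (w x ^ 2)) x ∂μ =
      ∫⁻ x, ENNReal.ofReal (t ^ (p - 3)) *
        Set.indicator {z : ℝ × α | w z.2 ≤ z.1} (fun z => ENNReal.ofReal (w z.2 ^ 2)) (t,
            x) ∂μ := by
    intro t
    rw [lintegral_const_mul' _ _ ENNReal.ofReal_ne_top]
    rfl
  simp_rw [h1]
  rw [lintegral_lintegral_swap hmeas.aemeasurable,
    ← lintegral_const_mul' _ _ ENNReal.ofReal_ne_top]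
  refine lintegral_congr fun x => ?_
  have h2 : ∀ t : ℝ, ENNReal.ofReal (t ^ (p - 3)) *
        Set.indicator {z : ℝ × α | w z.2 ≤ z.1} (fun z => ENNReal.ofReal (w z.2 ^ 2)) (t, x) =
      ENNReal.ofReal (w x ^ 2) *
        Set.indicator (Set.Ici (w x)) (fun t => ENNReal.ofReal (t ^ (p - 3))) t := by
    intro t
    by_cases ht : w x ≤ t
    · rw [Set.indicator_of_mem (show (t, x) ∈ {z : ℝ × α | w z.2 ≤ z.1} from ht),
        Set.indicator_of_mem (show t ∈ Set.Ici (w x) from ht), mul_comm]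
    · rw [Set.indicator_of_notMem (show (t, x) ∉ {z : ℝ × α | w z.2 ≤ z.1} from ht),
        Set.indicator_of_notMem (show t ∉ Set.Ici (w x) from ht), mul_zero, mul_zero]
  simp_rw [h2]
  rw [lintegral_const_mul' _ _ ENNReal.ofReal_ne_top]
  -- If w x = 0 the integral over t diverges at 0, but its factor w x ^ 2 vanishes.
  rcases (hw0 x).eq_or_lt with h | h
  · rw [← h, Real.zero_rpow hp0.ne']; simp
  · rw [lintegral_indicator measurableSet_Ici,
      Measure.restrict_restrict measurableSet_Ici, Set.inter_eq_left.mpr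
        (show Set.Ici (w x) ⊆ Set.Ioi 0 from fun t ht => h.trans_le ht),
      lintegral_Ici_rpow h (by linarith), ← ENNReal.ofReal_mul (by positivity),
      ← ENNReal.ofReal_mul (by rw [one_div]; exact inv_nonneg.mpr (by linarith))]
    congr 1
    have e : p - 3 + 1 = p - 2 := by ring
    rw [e, Real.rpow_sub h, Real.rpow_two]
    have h3 : p - 2 ≠ 0 := by linarith
    have h4 : 2 - p ≠ 0 := by linarith
    field_simp
    ring

end Marcinkiewicz

/-! ### Marcinkiewicz interpolation for T_m. -/

namespace HomSymbol

variable {n : ℕ}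

theorem eLpNorm_two_op_le (m : HomSymbol n) {M : ℝ} (hM : ∀ ξ, ‖m.toFun ξ‖ ≤ M)
    (f : Lp ℂ 2 (volume : Measure (Rn n))) :
    eLpNorm (m.op f) 2 volume ≤ ENNReal.ofReal M * eLpNorm f 2 volume := by
  have h1 : ∀ g : Lp ℂ 2 (volume : Measure (Rn n)), 
      eLpNorm (𝓕 g : Lp ℂ 2 (volume : Measure (Rn n))) 2 volume = eLpNorm g 2 volume := by
    intro g
    have := Lp.norm_fourier_eq g
    rw [Lp.norm_def, Lp.norm_def] at this
    exact (ENNReal.toReal_eq_toReal_iff' (Lp.eLpNorm_ne_top _) (Lp.eLpNorm_ne_top _)).mp this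
  rw [← h1 (m.op f), ← h1 f, fourier_op, eLpNorm_congr_ae (m.memLp_mul (𝓕 f)).coeFn_toLp]
  refine eLpNorm_le_mul_eLpNorm_of_ae_le_mul (ae_of_all _ fun ξ => ?_) 2
  rw [norm_mul]
  exact mul_le_mul_of_nonneg_right (hM ξ) (norm_nonneg _)

theorem mul_measure_op_le (m : HomSymbol n) (f : Lp ℂ 2 (volume : Measure (Rn n)))
    (hf : eLpNorm f 1 volume ≠ ∞) {t : ℝ} (ht : 0 < t) :
    ENNReal.ofReal t * volume {x | t < ‖m.op f x‖} ≤ m.normWeakL1 * eLpNorm f 1 volume := by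
  rcases eq_or_ne (eLpNorm f 1 volume) 0 with h0 | h0
  · have hf0 : f = 0 := by
      rw [eLpNorm_eq_zero_iff (Lp.aestronglyMeasurable f) one_ne_zero] at h0
      exact Lp.eq_zero_iff_ae_eq_zero.mpr h0
    have h1 : m.op f = 0 := by
      have := m.op_smul 0 f
      rw [zero_smul, zero_smul] at this
      rw [hf0, this]
    have h2 : volume {x | t < ‖m.op f x‖} = 0 := by
      rw [h1]
      refine measure_mono_null (t := {x | ¬ ((0 : Lp ℂ 2 (volume : Measure (Rn n))) x = 0)}) ?_
        (Lp.coeFn_zero ℂ 2 (volume : Measure (Rn n)))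
      intro x hx hx'
      simp only [Set.mem_ofPred_eq] at hx
      rw [hx', norm_zero] at hx
      linarith
    rw [h2, mul_zero]
    exact zero_le
  · set N := (eLpNorm f 1 volume).toReal with hN
    have hNpos : 0 < N := ENNReal.toReal_pos h0 hf
    have hNe : ENNReal.ofReal N = eLpNorm f 1 volume := ENNReal.ofReal_toReal hf
    set c : ℂ := ((N⁻¹ : ℝ) : ℂ) with hc
    have hcn : ‖c‖ = N⁻¹ := by
      rw [hc, Complex.norm_real, Real.norm_of_nonneg (inv_nonneg.mpr hNpos.le)]
    have hce : ‖c‖ₑ = (eLpNorm f 1 volume)⁻¹ := by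
      rw [← hNe, ← ENNReal.ofReal_inv_of_pos hNpos, ← ofReal_norm, hcn]
    have h1 : eLpNorm (c • f : Lp ℂ 2 (volume : Measure (Rn n))) 1 volume = 1 := by
      rw [eLpNorm_congr_ae (Lp.coeFn_smul c f), eLpNorm_const_smul, hce,
          ENNReal.inv_mul_cancel h0 hf]
    have h2 : weakL1Norm (m.op (c • f)) ≤ m.normWeakL1 := by
      rw [normWeakL1]
      exact le_iSup₂ (f := fun (f : Lp ℂ 2 (volume : Measure (Rn n)))
        (_ : eLpNorm f 1 volume = 1) => weakL1Norm (m.op f)) (c • f) h1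
    have h3 : ENNReal.ofReal (t / N) * volume {x | t < ‖m.op f x‖} ≤ weakL1Norm (m.op (c • f)) := by
      rw [weakL1Norm]
      refine le_trans (le_of_eq ?_) (le_iSup (fun t : ℝ≥0 => (t : ℝ≥0∞) *
        volume {x | (t : ℝ≥0∞) < ‖(m.op (c • f)) x‖ₑ}) (Real.toNNReal (t / N)))
      rw [ENNReal.ofReal]
      congr 1
      refine measure_congr ?_
      rw [op_smul]
      filter_upwards [Lp.coeFn_smul c (m.op f)] with x hx
      refine propext ?_
      change t < ‖m.op f x‖ ↔ ENNReal.ofReal (t / N) < ‖(c • m.op f : Lp ℂ 2 volume) x‖ₑ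
      rw [hx, Pi.smul_apply, ← ofReal_norm, norm_smul, hcn, ENNReal.ofReal_lt_ofReal_iff_of_nonneg
        (by positivity), inv_mul_eq_div, div_lt_div_iff_of_pos_right hNpos]
    have h4 := h3.trans h2
    rw [ENNReal.ofReal_div_of_pos hNpos, ← ENNReal.mul_div_right_comm, hNe] at h4
    exact (ENNReal.div_le_iff h0 hf).mp h4

/-- Split f at height t: where |T_m f| > 2t, the image of one of the two parts exceeds t. The large
part is controlled by the weak L¹ norm, the small part by Chebyshev's inequality in L². -/
theorem measure_op_le (m : HomSymbol n) {M : ℝ} (hM0 : 0 < M) (hM : ∀ ξ, ‖m.toFun ξ‖ ≤ M)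
    (f : Lp ℂ 2 (volume : Measure (Rn n))) {t : ℝ} (ht : 0 < t) :
    volume {x | t < ‖m.op f x‖ / 2} ≤
      m.normWeakL1 * (ENNReal.ofReal t⁻¹ *
        ∫⁻ x, Set.indicator {x | t < ‖f x‖} (fun x => ENNReal.ofReal ‖f x‖) x) +
      ENNReal.ofReal (M ^ 2) * (ENNReal.ofReal (t ^ 2)⁻¹ *
        ∫⁻ x, Set.indicator {x | ‖f x‖ ≤ t} (fun x => ENNReal.ofReal (‖f x‖ ^ 2)) x) := by
  have hfm : Measurable f := (Lp.stronglyMeasurable f).measurable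
  have hS : MeasurableSet {x | t < ‖f x‖} := measurableSet_lt measurable_const hfm.norm
  set S : Set (Rn n) := {x | t < ‖f x‖} with hSdef
  have hSc : Sᶜ = {x | ‖f x‖ ≤ t} := by ext x; simp [S]
  have hm1 : MemLp (S.indicator f) 2 := (Lp.memLp f).indicator hS
  have hm2 : MemLp (Sᶜ.indicator f) 2 := (Lp.memLp f).indicator hS.compl
  set f1 := hm1.toLp _ with hf1
  set f2 := hm2.toLp _ with hf2
  have hsum : f = f1 + f2 := by
    apply Lp.ext
    filter_upwards [hm1.coeFn_toLp, hm2.coeFn_toLp, Lp.coeFn_add f1 f2] with x h1 h2 h3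
    rw [h3, Pi.add_apply, h1, h2]
    exact (Set.indicator_self_add_compl_apply S f x).symm
  have hn1 : eLpNorm f1 1 volume = ∫⁻ x, S.indicator (fun x => ENNReal.ofReal ‖f x‖) x := by
    rw [eLpNorm_congr_ae hm1.coeFn_toLp, eLpNorm_one_eq_lintegral_enorm]
    refine lintegral_congr fun x => ?_
    by_cases hx : x ∈ S
    · rw [Set.indicator_of_mem hx, Set.indicator_of_mem hx, ofReal_norm]
    · rw [Set.indicator_of_notMem hx, Set.indicator_of_notMem hx, enorm_zero]
  have hsq : ∀ g : Rn n → ℂ, MemLp g 2 → ∫⁻ x, ENNReal.ofReal (‖g x‖ ^ 2) < ∞ := by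
    intro g hg
    have := (hg.integrable_norm_pow two_ne_zero).lintegral_lt_top
    simpa using this
  -- The large part is integrable since t|f| ≤ |f|² where |f| > t.
  have hfin : eLpNorm f1 1 volume ≠ ∞ := by
    rw [hn1]
    have h1 : ∀ x, S.indicator (fun x => ENNReal.ofReal ‖f x‖) x ≤
        ENNReal.ofReal t⁻¹ * ENNReal.ofReal (‖f x‖ ^ 2) := by
      intro x
      by_cases hx : x ∈ S
      · rw [Set.indicator_of_mem hx, ← ENNReal.ofReal_mul (by positivity)]
        apply ENNReal.ofReal_le_ofReal
        have : t < ‖f x‖ := hx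
        rw [inv_mul_eq_div, le_div_iff₀ ht]
        nlinarith [norm_nonneg (f x)]
      · rw [Set.indicator_of_notMem hx]; exact zero_le
    refine ((lintegral_mono h1).trans_lt ?_).ne
    rw [lintegral_const_mul' _ _ ENNReal.ofReal_ne_top]
    exact ENNReal.mul_lt_top ENNReal.ofReal_lt_top (hsq f (Lp.memLp f))
  have hcover : volume {x | t < ‖m.op f x‖ / 2} ≤
      volume {x | t < ‖m.op f1 x‖} + volume {x | t < ‖m.op f2 x‖} := by
    refine le_trans (measure_mono_ae ?_) (measure_union_le _ _)
    rw [hsum, op_add]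
    filter_upwards [Lp.coeFn_add (m.op f1) (m.op f2)] with x hx
    intro (hlt : t < ‖(m.op f1 + m.op f2 : Lp ℂ 2 volume) x‖ / 2)
    change t < ‖m.op f1 x‖ ∨ t < ‖m.op f2 x‖
    rw [hx, Pi.add_apply] at hlt
    by_contra! hcon
    linarith [norm_add_le (m.op f1 x) (m.op f2 x)]
  refine hcover.trans (add_le_add ?_ ?_)
  · have h1 := m.mul_measure_op_le f1 hfin ht
    rw [hn1] at h1
    have ht0 : ENNReal.ofReal t ≠ 0 := by simpa using ht
    rw [ENNReal.ofReal_inv_of_pos ht, mul_left_comm]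
    rw [← ENNReal.div_eq_inv_mul, ENNReal.le_div_iff_mul_le (Or.inl ht0)
      (Or.inl ENNReal.ofReal_ne_top), mul_comm]
    exact h1
  · have h1 := m.eLpNorm_two_op_le hM f2
    have e2 : ∀ g : Rn n → ℂ, AEStronglyMeasurable g volume → eLpNorm g 2 volume ^ (2 : ℝ) =
        ∫⁻ x, ENNReal.ofReal (‖g x‖ ^ 2) := by
      intro g _
      rw [eLpNorm_eq_lintegral_rpow_enorm_toReal two_ne_zero ENNReal.ofNat_ne_top,
          ← ENNReal.rpow_mul]
      simp only [ENNReal.toReal_ofNat, one_div, inv_mul_cancel₀ (two_ne_zero (α := ℝ)),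
        ENNReal.rpow_one]
      refine lintegral_congr fun x => ?_
      rw [← ofReal_norm, ENNReal.ofReal_rpow_of_nonneg (norm_nonneg _) two_pos.le, Real.rpow_two]
    have h2 : ∫⁻ x, ENNReal.ofReal (‖m.op f2 x‖ ^ 2) ≤ ENNReal.ofReal (M ^ 2) *
        ∫⁻ x, Set.indicator {x | ‖f x‖ ≤ t} (fun x => ENNReal.ofReal (‖f x‖ ^ 2)) x := by
      have h3 := ENNReal.rpow_le_rpow h1 (two_pos (α := ℝ)).le
      rw [ENNReal.mul_rpow_of_nonneg _ _ two_pos.le, e2 _ (Lp.aestronglyMeasurable _),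
        eLpNorm_congr_ae hm2.coeFn_toLp, e2 _ hm2.1, ENNReal.ofReal_rpow_of_pos hM0,
        Real.rpow_two] at h3
      refine h3.trans (le_of_eq ?_)
      congr 1
      refine lintegral_congr fun x => ?_
      rw [← hSc]
      by_cases hx : x ∈ Sᶜ
      · rw [Set.indicator_of_mem hx, Set.indicator_of_mem hx]
      · rw [Set.indicator_of_notMem hx, Set.indicator_of_notMem hx]; simp
    have h4 : ENNReal.ofReal (t ^ 2) * volume {x | t < ‖m.op f2 x‖} ≤
        ∫⁻ x, ENNReal.ofReal (‖m.op f2 x‖ ^ 2) := by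
      have hmo : Measurable (m.op f2) := (Lp.stronglyMeasurable _).measurable
      refine le_trans ?_ (mul_meas_ge_le_lintegral
        (ENNReal.measurable_ofReal.comp (hmo.norm.pow_const 2)) (ENNReal.ofReal (t ^ 2)))
      gcongr
      intro (hx : t < _)
      exact ENNReal.ofReal_le_ofReal (pow_le_pow_left₀ ht.le hx.le 2)
    have ht0 : ENNReal.ofReal (t ^ 2) ≠ 0 := by simpa using ht.ne'
    have ht2 : 0 < t ^ 2 := by positivity
    rw [ENNReal.ofReal_inv_of_pos ht2, mul_left_comm]
    rw [← ENNReal.div_eq_inv_mul, ENNReal.le_div_iff_mul_le (Or.inl ht0)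
      (Or.inl ENNReal.ofReal_ne_top), mul_comm]
    exact h4.trans h2

/-- Interpolation between the weak `L¹` bound and the `L²` bound. -/
theorem normLp_le (m : HomSymbol n) {M : ℝ} (hM0 : 0 < M) (hM : ∀ ξ, ‖m.toFun ξ‖ ≤ M) {p : ℝ}
    (hp : 1 < p) (hp2 : p < 2) :
    m.normLp (ENNReal.ofReal p) ≤ (ENNReal.ofReal (2 ^ p * p) *
      (m.normWeakL1 * ENNReal.ofReal (1 / (p - 1)) +
        ENNReal.ofReal (M ^ 2) * ENNReal.ofReal (1 / (2 - p)))) ^ (1 / p) := by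
  have hp0 : 0 < p := by linarith
  have hpE : ENNReal.ofReal p ≠ 0 := by simpa using hp0
  rcases eq_or_ne m.normWeakL1 ∞ with hA | hA
  · have h1 : ENNReal.ofReal (1 / (p - 1)) ≠ 0 := by simpa using hp
    have h2 : ENNReal.ofReal (2 ^ p * p) ≠ 0 := by
      have : 0 < (2 : ℝ) ^ p * p := by positivity
      simpa using this
    rw [hA, ENNReal.top_mul h1, top_add, ENNReal.mul_top h2, ENNReal.top_rpow_of_pos (by
        positivity)]
    exact le_top
  rw [normLp]
  refine iSup₂_le fun f hf => ?_
  have hfm : Measurable f := (Lp.stronglyMeasurable f).measurable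
  have hTm : Measurable (m.op f) := (Lp.stronglyMeasurable _).measurable
  have e : ∀ g : Rn n → ℂ, eLpNorm g (ENNReal.ofReal p) volume =
      (∫⁻ x, ENNReal.ofReal (‖g x‖ ^ p)) ^ (1 / p) := by
    intro g
    rw [eLpNorm_eq_lintegral_rpow_enorm_toReal hpE ENNReal.ofReal_ne_top,
        ENNReal.toReal_ofReal hp0.le]
    congr 1
    refine lintegral_congr fun x => ?_
    rw [← ofReal_norm, ENNReal.ofReal_rpow_of_nonneg (norm_nonneg _) hp0.le]
  have hf1 : ∫⁻ x, ENNReal.ofReal (‖f x‖ ^ p) = 1 := by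
    rw [e] at hf
    have := congrArg (fun y => y ^ p) hf
    simpa [← ENNReal.rpow_mul, hp0.ne'] using this
  rw [e]
  refine ENNReal.rpow_le_rpow ?_ (by positivity)
  -- The layer-cake formula is used for |T_m f|/2, the function in `measure_op_le`; this costs the
  -- factor 2^p.
  have h1 : ∫⁻ x, ENNReal.ofReal (‖m.op f x‖ ^ p) =
      ENNReal.ofReal (2 ^ p) * ∫⁻ x, ENNReal.ofReal ((‖m.op f x‖ / 2) ^ p) := by
    rw [← lintegral_const_mul' _ _ ENNReal.ofReal_ne_top]
    refine lintegral_congr fun x => ?_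
    rw [← ENNReal.ofReal_mul (by positivity), ← Real.mul_rpow (by positivity) (by positivity),
      mul_div_cancel₀ _ (two_ne_zero)]
  rw [h1, lintegral_rpow_eq_lintegral_meas_lt_mul volume (ae_of_all _ fun x => by positivity)
    (hTm.norm.div_const 2).aemeasurable hp0, ← mul_assoc,
    ← ENNReal.ofReal_mul (by positivity)]
  gcongr
  have h2 := lintegral_rpow_mul_lintegral_large (μ := (volume : Measure (Rn n)))
    (w := fun x => ‖f x‖) hfm.norm (fun x => norm_nonneg _) hp
  have h3 := lintegral_rpow_mul_lintegral_small (μ := (volume : Measure (Rn n)))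
    (w := fun x => ‖f x‖) hfm.norm (fun x => norm_nonneg _) hp0 hp2
  rw [hf1, mul_one] at h2 h3
  -- Monotonicity in t provides the measurability needed to split the integral.
  have hanti : Antitone fun t : ℝ =>
      ∫⁻ x, Set.indicator {x | t < ‖f x‖} (fun x => ENNReal.ofReal ‖f x‖) x := fun s t hst =>
    lintegral_mono fun x => Set.indicator_le_indicator_of_subset
      (fun y (hy : t < ‖f y‖) => hst.trans_lt hy) (fun _ => zero_le) x
  rw [← h2, ← h3, ← lintegral_const_mul' _ _ hA, ← lintegral_const_mul' _ _ ENNReal.ofReal_ne_top,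
    ← lintegral_add_left]
  · refine setLIntegral_mono' measurableSet_Ioi fun t (ht : 0 < t) => ?_
    have h4 := mul_le_mul_left (m.measure_op_le hM0 hM f ht) (ENNReal.ofReal (t ^ (p - 1)))
    refine h4.trans (le_of_eq ?_)
    have e1 : t ^ (p - 2) = t⁻¹ * t ^ (p - 1) := by
      rw [← Real.rpow_neg_one, ← Real.rpow_add ht]; ring_nf
    have e2 : t ^ (p - 3) = (t ^ 2)⁻¹ * t ^ (p - 1) := by
      rw [← Real.rpow_two, ← Real.rpow_neg ht.le, ← Real.rpow_add ht]; ring_nf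
    rw [e1, e2, ENNReal.ofReal_mul (by positivity), ENNReal.ofReal_mul (by positivity)]
    ring
  · exact ((ENNReal.measurable_ofReal.comp (measurable_id.pow_const (p - 2))).mul
      hanti.measurable).const_mul _

end HomSymbol

/-! ### The endpoint p = 1 and the theorem. -/

section Main

variable {n : ℕ}

/-- It isolates the coefficients γ_{n,j,α}, so that α → n can be taken term by term. -/
theorem sphInner_sum (m : HomSymbol n) (J : ℕ) (c : ℕ → ℂ) (P : ℕ → MvPolynomial (Fin n) ℂ) :
    (sphInner m fun ω => ∑ j ∈ Finset.range J, c j * polyVal (P j) (ω : Rn n)) =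
      ∑ j ∈ Finset.range J, (starRingEnd ℂ) (c j) *
        sphInner m fun ω : Sph n => polyVal (P j) (ω : Rn n) := by
  have hint : ∀ j, Integrable (fun ω : Sph n => polyVal (P j) (ω : Rn n)) (surf n) := by
    intro j
    have hc : Continuous fun ω : Sph n => polyVal (P j) (ω : Rn n) :=
      (continuous_polyVal (P j)).comp continuous_subtype_val
    obtain ⟨C, hC⟩ := (isCompact_univ (X := Sph n)).exists_bound_of_continuousOn hc.continuousOn
    exact Integrable.of_bound hc.aestronglyMeasurable C (ae_of_all _ fun ω => hC ω (Set.mem_univ _))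
  simp only [sphInner]
  simp_rw [← integral_const_mul]
  rw [← integral_finsetSum]
  · refine integral_congr_ae (ae_of_all _ fun ω => ?_)
    simp only [map_sum, map_mul, Finset.mul_sum]
    exact Finset.sum_congr rfl fun j _ => by ring
  · intro j _
    exact (integrable_mul_conj_of_integrable m (hint j)).const_mul _

/-- The weak type bound for finite sums of spherical harmonics. -/
theorem enorm_sphInner_le_normWeakL1 [NeZero n] (m : HomSymbol n) (J : ℕ)
    {P : ℕ → MvPolynomial (Fin n) ℂ} (hj : ∀ j, (P j).IsHomogeneous j)
    (hP : ∀ j, polyLaplacian n (P j) = 0) (hA : m.normWeakL1 ≠ ∞) :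
    ENNReal.ofReal ((1 / 2) / n) *
        ‖sphInner m fun ω => ∑ j ∈ Finset.range J,
          Complex.I ^ (-(j : ℤ)) * (gammaCoeff n j n : ℂ) * polyVal (P j) (ω : Rn n)‖ₑ ≤
      m.normWeakL1 *
        eLpNorm (fun ω : Sph n => ∑ j ∈ Finset.range J, polyVal (P j) (ω : Rn n)) ∞ (surf n) := by
  have hn : (0 : ℝ) < n := Nat.cast_pos.mpr (Nat.pos_of_ne_zero (NeZero.ne n))
  obtain ⟨M, hM0, hM⟩ := m.exists_norm_le
  set a := m.normWeakL1.toReal with ha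
  have haA : m.normWeakL1 = ENNReal.ofReal a := (ENNReal.ofReal_toReal hA).symm
  have ha0 : 0 ≤ a := ENNReal.toReal_nonneg
  set U : Sph n → ℂ := fun ω => ∑ j ∈ Finset.range J, polyVal (P j) (ω : Rn n) with hU
  have hUc : Continuous U :=
    continuous_finsetSum _ fun j _ => (continuous_polyVal (P j)).comp continuous_subtype_val
  have hUfin : eLpNorm U ∞ (surf n) ≠ ∞ := by
    obtain ⟨C, hC⟩ := (isCompact_univ (X := Sph n)).exists_bound_of_continuousOn hUc.continuousOn
    exact (MemLp.of_bound hUc.aestronglyMeasurable C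
      (ae_of_all _ fun ω => hC ω (Set.mem_univ _))).2.ne
  set σ := surf n Set.univ with hσ
  have hσ0 : σ ≠ 0 := surf_univ_ne_zero
  have hσt : σ ≠ ∞ := measure_ne_top _ _
  let I : ℝ → ℂ := fun s => sphInner m fun ω => ∑ j ∈ Finset.range J,
    Complex.I ^ (-(j : ℤ)) * (gammaCoeff n j (n * (1 - s)) : ℂ) * polyVal (P j) (ω : Rn n)
  -- The parametrization is p = 1/(1-s), q = 1/s. In the constant of `normLp_le` the factor 1/(p-1)
  -- = (1-s)/s is cleared by moving s inside the bracket.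
  let B : ℝ → ℝ := fun s => (2 ^ (1 / (1 - s)) * (1 / (1 - s)) *
    (a * (1 - s) + s * (M ^ 2 * ((1 - s) / (1 - 2 * s))))) ^ (1 - s)
  -- The finite-sum bound multiplied by s, which removes the pole of γ_{n,0,ns} on the left and the
  -- blow-up of the interpolation constant on the right.
  have key : ∀ s ∈ Set.Ioo (0 : ℝ) (1 / 2), ENNReal.ofReal (gammaReg n s) * ‖I s‖ₑ ≤
      ENNReal.ofReal (B s) * (σ * eLpNorm U ∞ (surf n)) := by
    rintro s ⟨hs0, hs1⟩
    have h1s : 0 < 1 - s := by linarith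
    have h2s : 0 < 1 - 2 * s := by linarith
    have hpq : (1 / (1 - s)).HolderConjugate (1 / s) := by
      rw [Real.holderConjugate_iff]
      refine ⟨by rw [lt_div_iff₀ h1s]; linarith, by field_simp; ring⟩
    have hnorm := m.normLp_le hM0 hM (p := 1 / (1 - s)) (by rw [lt_div_iff₀ h1s]; linarith)
      (by rw [div_lt_iff₀ h1s]; linarith)
    have e1 : 1 / (1 / (1 - s) - 1) = (1 - s) / s := by
      rw [div_sub_one h1s.ne', one_div_div]; ring_nf
    have e2 : 1 / (2 - 1 / (1 - s)) = (1 - s) / (1 - 2 * s) := by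
      rw [← one_div_div (1 - 2 * s) (1 - s)]
      congr 1
      field_simp
      ring
    rw [e1, e2, one_div_one_div, haA, ← ENNReal.ofReal_mul ha0,
        ← ENNReal.ofReal_mul (by positivity),
      ← ENNReal.ofReal_add (by positivity) (by positivity), ← ENNReal.ofReal_mul (by positivity),
      ENNReal.ofReal_rpow_of_nonneg (by positivity) h1s.le] at hnorm
    have hfinite := gammaCoeff_mul_enorm_le m J hj hP hpq (ne_top_of_le_ne_top
        ENNReal.ofReal_ne_top hnorm)
    rw [div_div_eq_mul_div, div_one, one_div_one_div, div_div_eq_mul_div, div_one,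
      gammaCoeff_zero_eq hs0.ne'] at hfinite
    -- Hölder's factor σ^s completes the σ^{1-s} already present to σ.
    have hUq : eLpNorm U (ENNReal.ofReal (1 / s)) (surf n) ≤ eLpNorm U ∞ (surf n) * σ ^ s := by
      have := eLpNorm_le_eLpNorm_mul_rpow_measure_univ (μ := surf n) (f := U)
        (p := ENNReal.ofReal (1 / s)) (q := ∞) le_top hUc.aestronglyMeasurable
      rw [ENNReal.toReal_ofReal (by positivity), ENNReal.toReal_top, one_div_one_div, div_zero,
        sub_zero, ← hσ] at this
      exact this
    have hσσ : σ ^ (1 - s) * σ ^ s = σ := by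
      rw [← ENNReal.rpow_add _ _ hσ0 hσt, sub_add_cancel, ENNReal.rpow_one]
    -- Pulling 1/s out of a power 1-s leaves s · s^{-(1-s)} = s^s ≤ 1.
    have hB : s * (2 ^ (1 / (1 - s)) * (1 / (1 - s)) *
        (a * ((1 - s) / s) + M ^ 2 * ((1 - s) / (1 - 2 * s)))) ^ (1 - s) ≤ B s := by
      have e3 : 2 ^ (1 / (1 - s)) * (1 / (1 - s)) *
          (a * ((1 - s) / s) + M ^ 2 * ((1 - s) / (1 - 2 * s))) =
          s⁻¹ * (2 ^ (1 / (1 - s)) * (1 / (1 - s)) *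
          (a * (1 - s) + s * (M ^ 2 * ((1 - s) / (1 - 2 * s))))) := by
        generalize (1 - s) / (1 - 2 * s) = y
        field_simp
      rw [e3, Real.mul_rpow (by positivity) (by positivity), ← mul_assoc]
      refine mul_le_of_le_one_left (by positivity) ?_
      rw [Real.inv_rpow hs0.le, ← Real.rpow_neg hs0.le]
      calc s * s ^ (-(1 - s)) = s ^ (1 + -(1 - s)) := by rw [Real.rpow_add hs0, Real.rpow_one]
        _ ≤ 1 := Real.rpow_le_one hs0.le (by linarith) (by linarith)
    calc ENNReal.ofReal (gammaReg n s) * ‖I s‖ₑ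
        = ENNReal.ofReal s * (ENNReal.ofReal (gammaReg n s / s) * ‖I s‖ₑ) := by
          rw [← mul_assoc, ← ENNReal.ofReal_mul hs0.le, mul_div_cancel₀ _ hs0.ne']
      _ ≤ ENNReal.ofReal s * (ENNReal.ofReal ((2 ^ (1 / (1 - s)) * (1 / (1 - s)) *
        (a * ((1 - s) / s) + M ^ 2 * ((1 - s) / (1 - 2 * s)))) ^ (1 - s)) * σ ^ (1 - s) *
          (eLpNorm U ∞ (surf n) * σ ^ s)) := by
          refine mul_le_mul_right ?_ _
          exact hfinite.trans (mul_le_mul' (mul_le_mul_left hnorm _) hUq)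
      _ = ENNReal.ofReal (s * (2 ^ (1 / (1 - s)) * (1 / (1 - s)) *
        (a * ((1 - s) / s) + M ^ 2 * ((1 - s) / (1 - 2 * s)))) ^ (1 - s)) *
          (σ * eLpNorm U ∞ (surf n)) := by
          rw [ENNReal.ofReal_mul hs0.le]
          conv_rhs => rw [← hσσ]
          ring
      _ ≤ _ := by gcongr
  have hI : Tendsto (fun s => ‖I s‖ₑ) (𝓝[>] 0) (𝓝 ‖I 0‖ₑ) := by
    refine (continuous_enorm.tendsto _).comp ?_
    refine Tendsto.mono_left ?_ nhdsWithin_le_nhds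
    simp only [I, sphInner_sum]
    refine tendsto_finsetSum _ fun j _ => Tendsto.mul_const _ ?_
    refine (Complex.continuous_conj.tendsto _).comp (Tendsto.const_mul _ ?_)
    refine (Complex.continuous_ofReal.tendsto _).comp ?_
    have h1 : ContinuousAt (gammaCoeff n j) (n * (1 - 0)) :=
      continuousAt_gammaCoeff (by simpa using hn) (by simp)
    exact ContinuousAt.comp' (f := fun s : ℝ => n * (1 - s)) h1 (by fun_prop)
  -- At s = 0 the term containing M drops out, and 2^p p becomes 2.
  have hBlim : Tendsto (fun s => ENNReal.ofReal (B s)) (𝓝[>] 0) (𝓝 (ENNReal.ofReal (2 * a))) := by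
    refine (ENNReal.continuous_ofReal.tendsto _).comp (Tendsto.mono_left ?_ nhdsWithin_le_nhds)
    have h0 : B 0 = 2 * a := by simp [B]
    rw [← h0]
    have hd : ContinuousAt (fun s : ℝ => 1 / (1 - s)) 0 :=
      continuousAt_const.div (by fun_prop) (by norm_num)
    have hd2 : ContinuousAt (fun s : ℝ => (1 - s) / (1 - 2 * s)) 0 :=
      ContinuousAt.div (by fun_prop) (by fun_prop) (by norm_num)
    have hd3 : ContinuousAt (fun s : ℝ => (2 : ℝ) ^ (1 / (1 - s))) 0 :=
      (Real.continuousAt_const_rpow two_ne_zero).comp' (f := fun s : ℝ => 1 / (1 - s)) hd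
    refine ContinuousAt.rpow ?_ (by fun_prop) (Or.inr (by norm_num))
    exact (hd3.mul hd).mul (ContinuousAt.add (by fun_prop)
      (continuousAt_id.mul (continuousAt_const.mul hd2)))
  have hReg : Tendsto (fun s => ENNReal.ofReal (gammaReg n s)) (𝓝[>] 0)
      (𝓝 (ENNReal.ofReal (gammaReg n 0))) :=
    (ENNReal.continuous_ofReal.tendsto _).comp
      ((continuousAt_gammaReg le_rfl one_pos).tendsto.mono_left nhdsWithin_le_nhds)
  have hlim := le_of_tendsto_of_tendsto
    (ENNReal.Tendsto.mul hReg (Or.inr enorm_ne_top) hI (Or.inr ENNReal.ofReal_ne_top))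
    (ENNReal.Tendsto.mul_const hBlim (Or.inr (ENNReal.mul_ne_top hσt hUfin)))
    (Filter.eventually_of_mem (Ioo_mem_nhdsGT (by norm_num : (0 : ℝ) < 1 / 2)) key)
  have hI0 : I 0 = sphInner m fun ω => ∑ j ∈ Finset.range J,
      Complex.I ^ (-(j : ℤ)) * (gammaCoeff n j n : ℂ) * polyVal (P j) (ω : Rn n) := by
    simp [I]
  -- Since σ = n `gammaReg n 0`, the residue cancels from both sides and 1/(2n) is left.
  rw [hI0, hσ, surf_univ_eq] at hlim
  generalize ‖sphInner m fun ω => ∑ j ∈ Finset.range J,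
      Complex.I ^ (-(j : ℤ)) * (gammaCoeff n j n : ℂ) * polyVal (P j) (ω : Rn n)‖ₑ = X at hlim ⊢
  have hr := gammaReg_pos (n := n) le_rfl one_pos
  have hc : ENNReal.ofReal (2 * n * gammaReg n 0) ≠ 0 := by
    have : 0 < 2 * n * gammaReg n 0 := by positivity
    exact (ENNReal.ofReal_pos.mpr this).ne'
  refine (ENNReal.mul_le_mul_iff_right hc ENNReal.ofReal_ne_top).mp ?_
  rw [← mul_assoc, ← ENNReal.ofReal_mul (by positivity), haA, ← mul_assoc,
    ← ENNReal.ofReal_mul (by positivity)]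
  rw [← mul_assoc, ← ENNReal.ofReal_mul (by positivity)] at hlim
  convert! hlim using 3
  · field_simp
  · ring

theorem theorem3 :
    ∃ c : ℝ, 0 < c ∧ ∀ n : ℕ, 2 ≤ n → ∃ cn : ℝ, 0 < cn ∧
      ∀ (p q : ℝ≥0∞), 1 ≤ p → p ≤ 2 → p⁻¹ + q⁻¹ = 1 →
      ∀ (m : HomSymbol n) (Y : ℕ → Sph n → ℂ) (u v : Sph n → ℂ),
        (∀ j, IsSphericalHarmonic n j (Y j)) →
        SeriesConverges q Y u →
        SeriesConverges 2
          (fun j ω => Complex.I ^ (-(j : ℤ)) * (gammaCoeff n j (n / p.toReal) : ℂ) * Y j ω) v →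
        (1 < p →
          ENNReal.ofReal (gammaCoeff n 0 (n / q.toReal)) / surf n Set.univ ^ (1 / p.toReal) *
              (‖sphInner m v‖ₑ / eLpNorm u q (surf n)) ≤ m.normLp p ∧
          ENNReal.ofReal (cn * (q.toReal - 1)) * (‖sphInner m v‖ₑ / eLpNorm u q (surf n)) ≤
            ENNReal.ofReal (gammaCoeff n 0 (n / q.toReal)) / surf n Set.univ ^ (1 / p.toReal) *
              (‖sphInner m v‖ₑ / eLpNorm u q (surf n))) ∧
        (p = 1 →
          ENNReal.ofReal (c / n) * (‖sphInner m v‖ₑ / eLpNorm u ∞ (surf n)) ≤ m.normWeakL1) := by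
  -- The value 1/2 is the reciprocal of 2^p p at p = 1.
  refine ⟨1 / 2, by norm_num, fun n hn => ?_⟩
  have : NeZero n := ⟨by omega⟩
  obtain ⟨cn, hcn, hcn'⟩ := exists_le_gammaCoeff_div (n := n)
  refine ⟨cn, hcn, fun p q hp1 hp2 hpq m Y u v hY hu hv => ?_⟩
  choose P hPj hPl hPv using hY
  have hPl' : ∀ j, polyLaplacian n (P j) = 0 := fun j => by rw [polyLaplacian_apply, hPl j]
  obtain rfl : Y = fun j (ω : Sph n) => polyVal (P j) (ω : Rn n) := by
    ext j ω; exact hPv j ω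
  have hYc : ∀ j, Continuous fun ω : Sph n => polyVal (P j) (ω : Rn n) :=
    fun j => (continuous_polyVal (P j)).comp continuous_subtype_val
  refine ⟨fun hp => ?_, fun hp => ?_⟩
  · have hpt : p ≠ ∞ := ne_top_of_le_ne_top ENNReal.ofNat_ne_top hp2
    have hHC : p.HolderConjugate q := ⟨by rw [hpq, inv_one]⟩
    have hqt : q ≠ ∞ := by
      rintro rfl
      rw [ENNReal.inv_top, add_zero, ENNReal.inv_eq_one] at hpq
      exact hp.ne' hpq
    have hq1 : 1 ≤ q := by
      rw [← ENNReal.inv_le_one, ← hpq]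
      exact le_add_self
    have hreal : p.toReal.HolderConjugate q.toReal := by
      rw [Real.holderConjugate_iff]
      refine ⟨?_, ?_⟩
      · rw [← ENNReal.toReal_one]
        exact (ENNReal.toReal_lt_toReal ENNReal.one_ne_top hpt).mpr hp
      · have h1 : p ≠ 0 := (zero_lt_one.trans hp).ne'
        have h2 : q ≠ 0 := (zero_lt_one.trans_le hq1).ne'
        rw [← ENNReal.toReal_inv, ← ENNReal.toReal_inv, ← ENNReal.toReal_add (by simpa) (by simpa),
          hpq, ENNReal.toReal_one]
    have hq2 : 2 ≤ q.toReal := by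
      have h1 : p.toReal ≤ 2 := by
        have := ENNReal.toReal_mono ENNReal.ofNat_ne_top hp2
        simpa using this
      have h2 := hreal.mul_eq_add
      have h3 := hreal.lt
      have h4 := hreal.symm.lt
      nlinarith
    refine ⟨?_, mul_le_mul_left (hcn' _ _ hreal hq2) _⟩
    rcases eq_or_ne (m.normLp p) ∞ with hA | hA
    · rw [hA]; exact le_top
    have hfin : ∀ J, ENNReal.ofReal (gammaCoeff n 0 (n / q.toReal)) *
        ‖sphInner m fun ω => ∑ j ∈ Finset.range J,
          Complex.I ^ (-(j : ℤ)) * (gammaCoeff n j (n / p.toReal) : ℂ) * polyVal (P j) (ω : Rn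
              n)‖ₑ ≤
        m.normLp p * surf n Set.univ ^ (1 / p.toReal) *
        eLpNorm (fun ω : Sph n => ∑ j ∈ Finset.range J, polyVal (P j) (ω : Rn n)) q (surf n) := by
      intro J
      have h := gammaCoeff_mul_enorm_le m J hPj hPl' hreal (by rwa [ENNReal.ofReal_toReal hpt])
      rwa [ENNReal.ofReal_toReal hpt, ENNReal.ofReal_toReal hqt] at h
    have hσ : surf n Set.univ ^ (1 / p.toReal) ≠ ∞ :=
      ENNReal.rpow_ne_top_of_nonneg (by positivity) (measure_ne_top _ _)
    have hlim := mul_enorm_sphInner_le_of_series m hYc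
      (fun j => (hYc j).const_mul _) hq1 hu hv ENNReal.ofReal_ne_top
      (ENNReal.mul_ne_top hA hσ) hfin
    have e : ∀ a b c d : ℝ≥0∞, a / b * (c / d) = a * c / d / b := by
      intro a b c d
      simp only [div_eq_mul_inv]
      ring
    rw [e]
    -- No nonvanishing of u is required: if its norm is 0, then `hlim` makes the numerator 0, and
    -- 0/0 = 0 in `ℝ≥0∞`.
    exact ENNReal.div_le_of_le_mul (ENNReal.div_le_of_le_mul hlim)
  · subst hp
    obtain rfl : q = ∞ := by
      rw [inv_one] at hpq
      have h1 : (1 : ℝ≥0∞) + q⁻¹ = 1 + 0 := by rw [hpq, add_zero]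
      exact ENNReal.inv_eq_zero.mp ((ENNReal.add_right_inj ENNReal.one_ne_top).mp h1)
    rcases eq_or_ne m.normWeakL1 ∞ with hA | hA
    · rw [hA]; exact le_top
    simp only [ENNReal.toReal_one, div_one] at hv
    have hlim := mul_enorm_sphInner_le_of_series m hYc
      (fun j => (hYc j).const_mul _) le_top hu hv ENNReal.ofReal_ne_top hA
      (fun J => enorm_sphInner_le_normWeakL1 m J hPj hPl' hA)
    rw [← mul_div_assoc]
    exact ENNReal.div_le_of_le_mul hlim

end Main

end
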